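/- Let $d\ge1$, let $\mathcal X\subseteq\mathbb R^d$ be nonempty, convex and compact with $\|x-y\|\le D$ for all $x,y\in\mathcal X$, let $\xi$ be a random variable, and consider $\min_{x\in\mathcal X} f(x)$ with $f(x)=\mathbb E_\xi[f(x;\xi)]$. Put $\mathcal G(x)=\max_{w\in\mathcal X}\langle w-x,-\nabla f(x)\rangle$ (the Frank–Wolfe gap). For $\beta>0$ and a unit vector $u$ let $$\hat\nabla_{u} f(x;\xi)=\frac{d\,(f(x+\beta u;\xi)-f(x;\xi))}{\beta}\,u ,$$ and let $f_\beta(x)$ be the average of $f(x+\beta u)$ over $u$ in the unit ball. **Algorithm (Acc-SZOFW with the uniform-sphere estimator).** Let $T\ge3$, $q\ge1$, $\eta=T^{-1/2}$, $\alpha_t=\frac1{t+1}$, $\theta_t=\frac1{(t+1)(t+2)}$, $\gamma_t=(1+\theta_t)\eta$, $\beta=d^{-1}T^{-1/2}$, $b_2=q$, $b_1=\lceil T/d\rceil$. (The condition $T\ge3$ means exactly that all $\eta,\gamma_t$ lie in $(0,1)$.) Start with $x_0=y_0=z_0\in\mathcal X$. For $t=0,\dots,T-1$: draw fresh independent samples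 $(\xi_i,u_i)$, with $u_i$ uniform on the unit sphere and independent of $\xi_i$; if $q\mid t$ put $v_t=\frac1{b_1}\sum_{i\le b_1}\hat\nabla_{u_i}f(z_t;\xi_i)$, otherwise put $v_t=v_{t-1}+\frac1{b_2}\sum_{i\le b_2}\big[\hat\nabla_{u_i}f(z_t;\xi_i)-\hat\nabla_{u_i}f(z_{t-1};\xi_i)\big]$; then let $w_t\in\arg\max_{w\in\mathcal X}\langle w,-v_t\rangle$ (by a fixed measurable selection rule, which may depend on $t$), and $$x_{t+1}=x_t+\gamma_t(w_t-x_t),\quad y_{t+1}=z_t+\eta(w_t-z_t),\quad z_{t+1}=(1-\alpha_{t+1})y_{t+1}+\alpha_{t+1}x_{t+1}.$$ The output is $z_\zeta$ with $\zeta$ uniform on $\{0,\dots,T-1\}$ and independent of the samples. **Assumptions.** Each $f(\cdot;\xi)$ is differentiable with $L$-Lipschitz gradient on an open set containing the closed $\beta$-neighbourhood of $\mathcal X$, where also $f(x;\xi)$ is integrable; $\mathbb E\|\hat\nabla_{u}f(x;\xi)-\nabla f_\beta(x)\|^2\le\sigma_2^2$ for all $x\in\mathcal X$; $f$ is bounded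 below on $\mathcal X$ and $f(x)-\inf_{\mathcal X}f\le\triangle$ for all $x\in\mathcal X$. **Theorem.** There are constants $C>0$ and $M\ge3$ depending only on $L,D,\triangle,\sigma_2$ (and so not on $d$, $T$, $q$ or the problem) such that in this setting $$\mathbb E[\mathcal G(z_\zeta)]=\frac1T\sum_{t=0}^{T-1}\mathbb E[\mathcal G(z_t)]\le C\,\frac{\sqrt d}{T^{1/2}}+C\,\frac{\sqrt d\,\ln T}{T^{3/2}},$$ all these expectations being of integrable variables. Moreover, for $0<\varepsilon\le1$, the choice $T=\lceil M d\varepsilon^{-2}\rceil$ and $q=b_2=\lceil\varepsilon^{-1}\rceil$ (and $b_1=\lceil T/d\rceil$) gives $\mathbb E[\mathcal G(z_\zeta)]\le\varepsilon$ with at most $C\,d\,\varepsilon^{-3}$ evaluations of the functions $f(\cdot;\xi)$ in total. -/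

import Mathlib

open MeasureTheory ProbabilityTheory
open scoped ENNReal RealInnerProductSpace

noncomputable section

namespace AccSZOFW

/-- `ℝ^d` with the Euclidean norm. -/
abbrev E (d : ℕ) : Type := EuclideanSpace ℝ (Fin d)

/-! ### Computations that count function queries -/

/-- A value together with the number of function evaluations spent on it. -/
structure Counted (α : Type*) where
  value : α
  queries : ℕ

namespace Counted

def pure {α : Type*} (a : α) : Counted α := ⟨a, 0⟩

def bind {α β : Type*} (c : Counted α) (k : α → Counted β) : Counted β :=
  ⟨(k c.value).value, c.queries + (k c.value).queries⟩

/-- The average of `b` computed vectors; all their queries are paid. -/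
def average {d : ℕ} (b : ℕ) (c : Fin b → Counted (E d)) : Counted (E d) :=
  ⟨(1 / (b : ℝ)) • ∑ i, (c i).value, ∑ i, (c i).queries⟩

end Counted

/-- Black-box access to `g`: one evaluation costs one query. -/
def oracle {d : ℕ} (g : E d → ℝ) (x : E d) : Counted ℝ := ⟨g x, 1⟩

/-! ### The uniform smoothing gradient estimator -/

/-- The estimator `(d (g(x + β u) - g(x)) / β) u`, for a function given by an oracle. -/
def uniGE {d : ℕ} (g : E d → Counted ℝ) (β : ℝ) (u x : E d) : Counted (E d) :=
  (g (x + β • u)).bind fun a =>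
  (g x).bind fun b =>
  Counted.pure (((d : ℝ) * (a - b) / β) • u)

/-- The uniform probability distribution on the unit sphere of `ℝ^d` (for `1 ≤ d`). -/
def unifSphere (d : ℕ) : Measure (E d) :=
  (((volume : Measure (E d)).toSphere Set.univ)⁻¹ • (volume : Measure (E d)).toSphere).map
    Subtype.val

/-- The smoothing `f_β(x)`: the average of `f(x + β u)` over `u` in the unit ball. -/
def smoothing {d : ℕ} (f : E d → ℝ) (β : ℝ) (x : E d) : ℝ :=
  ⨍ u in Metric.closedBall (0 : E d) 1, f (x + β • u)

/-! ### The stochastic problem and the Frank-Wolfe gap -/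

/-- The objective `f(x) = 𝔼 f(x; ξ)`, with `ξ` of law `P`. -/
def objective {d : ℕ} {Ξ : Type*} [MeasurableSpace Ξ] (F : E d → Ξ → ℝ) (P : Measure Ξ)
    (x : E d) : ℝ :=
  ∫ ξ, F x ξ ∂P

/-- The Frank-Wolfe gap `max_{w ∈ X} ⟨w - x, -∇f(x)⟩`. -/
def fwGap {d : ℕ} (X : Set (E d)) (f : E d → ℝ) (x : E d) : ℝ :=
  sSup ((fun w => ⟪w - x, -gradient f x⟫) '' X)

/-- The standing assumptions on the problem `min_{x ∈ X} 𝔼 f(x; ξ)`, for the smoothing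
parameter `β`. -/
structure Assumptions {d : ℕ} {Ξ : Type*} [MeasurableSpace Ξ] (X : Set (E d))
    (F : E d → Ξ → ℝ) (P : Measure Ξ) (β L D Δ σ : ℝ) : Prop where
  nonempty : X.Nonempty
  convex : Convex ℝ X
  compact : IsCompact X
  diam_le : ∀ x ∈ X, ∀ y ∈ X, ‖x - y‖ ≤ D
  measurable : Measurable (Function.uncurry F)
  /-- Every `f(·; ξ)` is `L`-smooth around the points at which the algorithm evaluates it. -/
  smooth : ∃ U : Set (E d), IsOpen U ∧ Metric.cthickening β X ⊆ U ∧
    (∀ x ∈ U, Integrable (F x) P) ∧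
    ∀ ξ, DifferentiableOn ℝ (fun x => F x ξ) U ∧
      ∀ x ∈ U, ∀ y ∈ U,
        ‖gradient (fun x => F x ξ) x - gradient (fun x => F x ξ) y‖ ≤ L * ‖x - y‖
  /-- `𝔼 ‖uniGE f_ξ (x) - ∇ f_β (x)‖² ≤ σ²`. -/
  variance : ∀ x ∈ X,
    ∫⁻ p : Ξ × E d,
      ‖(uniGE (oracle fun x => F x p.1) β p.2 x).value
        - gradient (smoothing (objective F P) β) x‖ₑ ^ 2 ∂(P.prod (unifSphere d))
      ≤ ENNReal.ofReal (σ ^ 2)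
  bddBelow : BddBelow (objective F P '' X)
  gap_le : ∀ x ∈ X, objective F P x - sInf (objective F P '' X) ≤ Δ

/-! ### The algorithm -/

/-- The parameters of the algorithm. -/
structure Params where
  α : ℕ → ℝ
  γ : ℕ → ℝ
  η : ℕ → ℝ
  β : ℝ
  q : ℕ
  b₁ : ℕ
  b₂ : ℕ

/-- What the algorithm remembers at the start of iteration `t`: the points `x_t, y_t, z_t`, the
previous `z_{t-1}, v_{t-1}`, and the number of function queries made so far. -/
structure State (d : ℕ) where
  x : E d
  y : E d
  z : E d
  zPrev : E d
  vPrev : E d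
  queries : ℕ

/-- The gradient estimate `v_t`: a fresh mini-batch of size `b₁` if `q ∣ t`, and otherwise a
correction of `v_{t-1}` by a mini-batch of size `b₂`, each sample using the same direction `u`
at `z_t` and at `z_{t-1}`. The sample `batch i` is a pair `(ξ_i, u_i)`. -/
def gradEstimate {d : ℕ} {Ξ : Type*} (p : Params) (F : E d → Ξ → ℝ) (t : ℕ) (s : State d)
    (batch : ℕ → Ξ × E d) : Counted (E d) :=
  if t % p.q = 0 then
    Counted.average p.b₁ fun i =>
      uniGE (oracle fun x => F x (batch i).1) p.β (batch i).2 s.z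
  else
    (Counted.average p.b₂ fun i =>
      (uniGE (oracle fun x => F x (batch i).1) p.β (batch i).2 s.z).bind fun g =>
      (uniGE (oracle fun x => F x (batch i).1) p.β (batch i).2 s.zPrev).bind fun g' =>
      Counted.pure (g - g')).bind fun a =>
    Counted.pure (a + s.vPrev)

/-- Iteration `t`. The map `lmo` returns a solution of the linear subproblem for `v_t`. -/
def step {d : ℕ} {Ξ : Type*} (p : Params) (F : E d → Ξ → ℝ) (lmo : E d → E d) (t : ℕ)
    (s : State d) (batch : ℕ → Ξ × E d) : State d :=
  let v := gradEstimate p F t s batch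
  let w := lmo v.value
  let x' := s.x + p.γ t • (w - s.x)
  let y' := s.z + p.η t • (w - s.z)
  { x := x'
    y := y'
    z := (1 - p.α (t + 1)) • y' + p.α (t + 1) • x'
    zPrev := s.z
    vPrev := v.value
    queries := s.queries + v.queries }

/-- The state after `t` iterations, started at `x₀ = y₀ = z₀`, where `batch t i` is the `i`-th
sample of iteration `t` and `lmo t` solves its linear subproblem. (The initial `zPrev`, `vPrev`
are never used, as iteration `0` starts an epoch.) -/
def run {d : ℕ} {Ξ : Type*} (p : Params) (F : E d → Ξ → ℝ) (lmo : ℕ → E d → E d) (z₀ : E d)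
    (batch : ℕ → ℕ → Ξ × E d) : ℕ → State d
  | 0 => ⟨z₀, z₀, z₀, z₀, 0, 0⟩
  | t + 1 => step p F (lmo t) t (run p F lmo z₀ batch t) (batch t)

/-- `lmo v ∈ argmax_{w ∈ X} ⟨w, -v⟩` for all `v`. -/
def IsLMO {d : ℕ} (X : Set (E d)) (lmo : E d → E d) : Prop :=
  Measurable lmo ∧ ∀ v, lmo v ∈ X ∧ ∀ w ∈ X, ⟪w, -v⟫ ≤ ⟪lmo v, -v⟫

/-- `α_t = 1/(t+1)`, `θ_t = 1/((t+1)(t+2))`, `η_t = T^{-1/2}`, `γ_t = (1+θ_t) η_t`,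
`β = d⁻¹ T^{-1/2}`, `b₂ = q` and `b₁ = T/d`, rounded up. -/
def params (d T q : ℕ) : Params where
  α t := 1 / ((t : ℝ) + 1)
  γ t := (1 + 1 / (((t : ℝ) + 1) * ((t : ℝ) + 2))) * (T : ℝ) ^ (-(1 / 2) : ℝ)
  η _ := (T : ℝ) ^ (-(1 / 2) : ℝ)
  β := (d : ℝ)⁻¹ * (T : ℝ) ^ (-(1 / 2) : ℝ)
  q := q
  b₁ := ⌈(T : ℝ) / (d : ℝ)⌉₊
  b₂ := q

/-- The randomness of a run: the samples `(ξ, u)` are i.i.d. with law `P ⊗ unifSphere`, and the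
output index `ζ` is uniform on `{0, …, T-1}` and independent of them. -/
structure IsRandomness {d T : ℕ} {Ξ Ω : Type*} [MeasurableSpace Ξ] [MeasurableSpace Ω]
    (P : Measure Ξ) (μ : Measure Ω) (sample : ℕ → ℕ → Ω → Ξ × E d) (ζ : Ω → Fin T) : Prop where
  measurable_sample : ∀ t i, Measurable (sample t i)
  law_sample : ∀ t i, μ.map (sample t i) = P.prod (unifSphere d)
  iIndep_sample : iIndepFun (fun p : ℕ × ℕ => sample p.1 p.2) μ
  measurable_index : Measurable ζ
  law_index : ∀ k, μ (ζ ⁻¹' {k}) = (T : ℝ≥0∞)⁻¹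
  indep_index : IndepFun ζ (fun ω (p : ℕ × ℕ) => sample p.1 p.2 ω) μ

end AccSZOFW

end

open AccSZOFW

namespace AccSZOFW

/-! ### The uniform distribution on the sphere -/

/-! Write `η = T^{-1/2}`. Smoothness is applied twice per iteration, from `z_t` to `y_{t+1}` and
from `y_{t+1}` to `z_{t+1}`. The first move is a Frank–Wolfe step: it gains `η` times the gap and
loses `η D ‖v_t - ∇f(z_t)‖`. The second is the momentum move `(x_{t+1} - y_{t+1}) / (t+2)`. Since
`X` may be thin, `‖∇f‖` has no bound in terms of `L, D, Δ`, but `∇f` paired with a difference of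
points of `X` does (`inner_gradient_le`), and `x_t - y_t` behaves like `η` times such a difference
(`inner_run_x_sub_y_le`). Telescoping (`stepSize_mul_fwGap_le`, `average_fwGap_le`) leaves `O(η)`
plus the average gradient error.

That error is split at the true mean `m(z)` of the estimator. Linearizing on the sphere gives `‖m(z)
- ∇f(z)‖ ≤ L d β = L η`, so the identity `m = ∇f_β` is never needed. The deviation `v_t - m(z_t)` is
a martingale within each epoch. A restart has second moment at most `σ² / b₁ ≤ σ² d η²`. A
correction adds `O(d η²) / q`, because `𝔼 ⟪a, u⟫² = ‖a‖² / d` turns the factor `d²` of the squared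
estimator into `d`, and because `z_t` moves by at most `2 η D`. Fewer than `q` corrections occur
between restarts, so the root mean square error is `O(√d η)`.

The average gap is thus `O(√d / √T)` without the logarithmic term. With `T` of order `d ε⁻²` and `q`
of order `ε⁻¹`, restarts and corrections each cost `O(d ε⁻³)` queries. -/

theorem isProbabilityMeasure_unifSphere {d : ℕ} (hd : 1 ≤ d) :
    IsProbabilityMeasure (unifSphere d) := by
  have : Nontrivial (E d) := by
    have : Nonempty (Fin d) := ⟨⟨0, hd⟩⟩
    infer_instance
  constructor
  rw [unifSphere, Measure.map_apply measurable_subtype_coe MeasurableSet.univ, Set.preimage_univ,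
    Measure.smul_apply, smul_eq_mul]
  refine ENNReal.inv_mul_cancel ?_ (measure_ne_top _ _)
  exact (Measure.measure_univ_ne_zero).2 (Measure.toSphere_ne_zero _)

theorem ae_norm_eq_one_unifSphere (d : ℕ) : ∀ᵐ u ∂unifSphere d, ‖u‖ = 1 := by
  rw [unifSphere, ae_map_iff measurable_subtype_coe.aemeasurable
    (measurableSet_eq_fun measurable_norm measurable_const)]
  exact Filter.Eventually.of_forall fun u => by simp

open scoped Pointwise in
/-- The uniform distribution on the sphere is invariant under linear isometries. -/
theorem map_unifSphere {d : ℕ} (φ : E d ≃ₗᵢ[ℝ] E d) :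
    (unifSphere d).map φ = unifSphere d := by
  -- The surface measure of `s` is `d` times the volume of the cone over it; isometries commute with
  -- forming cones and preserve volume.
  have key : ∀ s : Set (E d), MeasurableSet s →
      (volume : Measure (E d)).toSphere (Subtype.val ⁻¹' s) =
        d * volume (Set.Ioo (0 : ℝ) 1 • (Metric.sphere (0 : E d) 1 ∩ s)) := by
    intro s hs
    rw [Measure.toSphere_apply' _ (measurable_subtype_coe hs), Subtype.image_preimage_coe]
    simp
  ext s hs
  have hφ : Measurable φ := φ.continuous.measurable
  rw [Measure.map_apply hφ hs, unifSphere, Measure.map_apply measurable_subtype_coe (hφ hs),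
    Measure.map_apply measurable_subtype_coe hs, Measure.smul_apply, Measure.smul_apply,
    key _ (hφ hs), key _ hs]
  congr 2
  have : Set.Ioo (0 : ℝ) 1 • (Metric.sphere (0 : E d) 1 ∩ φ ⁻¹' s) =
      φ ⁻¹' (Set.Ioo (0 : ℝ) 1 • (Metric.sphere (0 : E d) 1 ∩ s)) := by
    ext x
    simp only [Set.mem_smul, Set.mem_preimage, Set.mem_inter_iff, mem_sphere_zero_iff_norm]
    constructor
    · rintro ⟨r, hr, y, ⟨hy, hys⟩, rfl⟩
      exact ⟨r, hr, φ y, ⟨by simpa using hy, hys⟩, by simp⟩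
    · rintro ⟨r, hr, y, ⟨hy, hys⟩, h⟩
      exact ⟨r, hr, φ.symm y, ⟨by simpa using hy, by simpa using hys⟩,
        φ.injective (by simpa using h)⟩
  rw [this]
  exact MeasurePreserving.measure_preimage_equiv (f := φ.toMeasurableEquiv) φ.measurePreserving _

theorem integrable_unifSphere_of_bound {d : ℕ} (hd : 1 ≤ d) {V : Type*} [NormedAddCommGroup V]
    {g : E d → V} (hg : AEStronglyMeasurable g (unifSphere d)) (C : ℝ)
    (h : ∀ u, ‖u‖ = 1 → ‖g u‖ ≤ C) : Integrable g (unifSphere d) := by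
  have := isProbabilityMeasure_unifSphere hd
  exact Integrable.of_bound hg C ((ae_norm_eq_one_unifSphere d).mono h)

theorem integrable_inner_sq_unifSphere {d : ℕ} (hd : 1 ≤ d) (a : E d) :
    Integrable (fun u => ⟪a, u⟫ ^ 2) (unifSphere d) := by
  refine integrable_unifSphere_of_bound hd (by fun_prop) (‖a‖ ^ 2) fun u hu => ?_
  rw [norm_pow]
  gcongr
  simpa [hu] using norm_inner_le_norm (𝕜 := ℝ) a u

/-- `𝔼 ⟪a, u⟫² = ‖a‖² / d` for `u` uniform on the sphere. -/
theorem integral_inner_sq_unifSphere {d : ℕ} (hd : 1 ≤ d) (a : E d) :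
    ∫ u, ⟪a, u⟫ ^ 2 ∂unifSphere d = ‖a‖ ^ 2 / d := by
  have := isProbabilityMeasure_unifSphere hd
  have hinv : ∀ v w : E d, ‖v‖ = ‖w‖ →
      ∫ u, ⟪v, u⟫ ^ 2 ∂unifSphere d = ∫ u, ⟪w, u⟫ ^ 2 ∂unifSphere d := by
    intro v w h
    -- The reflection in the hyperplane orthogonal to `v - w` carries `v` to `w`. Hence the `d`
    -- coordinate directions all contribute equally, and their contributions add up to `‖a‖² ‖u‖² =
    -- ‖a‖²`.
    set φ := (Submodule.span ℝ {v - w})ᗮ.reflection with hφ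
    have hvw : φ v = w := Submodule.reflection_sub h
    conv_rhs => rw [← map_unifSphere φ]
    rw [integral_map φ.continuous.aemeasurable (by fun_prop)]
    simp [← hvw]
  have hsum : ∑ i, ∫ u, ⟪(EuclideanSpace.single i ‖a‖ : E d), u⟫ ^ 2 ∂unifSphere d = ‖a‖ ^ 2 := by
    rw [← integral_finsetSum _ fun i _ => integrable_inner_sq_unifSphere hd _]
    have : ∀ᵐ u ∂unifSphere d,
        ∑ i, ⟪(EuclideanSpace.single i ‖a‖ : E d), u⟫ ^ 2 = ‖a‖ ^ 2 := by
      filter_upwards [ae_norm_eq_one_unifSphere d] with u hu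
      simp only [EuclideanSpace.inner_single_left, mul_pow, ← Finset.mul_sum]
      have := EuclideanSpace.real_norm_sq_eq u
      rw [← this, hu]
      simp
    rw [integral_congr_ae this]
    simp
  rw [Finset.sum_congr rfl fun i _ => hinv (EuclideanSpace.single i ‖a‖) a (by simp)] at hsum
  have hd' : (d : ℝ) ≠ 0 := by positivity
  simp at hsum
  field_simp
  linarith

/-- `𝔼 ⟪a, u⟫ u = a / d` for `u` uniform on the sphere. -/
theorem integral_inner_smul_unifSphere {d : ℕ} (hd : 1 ≤ d) (a : E d) :
    ∫ u, ⟪a, u⟫ • u ∂unifSphere d = (d : ℝ)⁻¹ • a := by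
  refine ext_inner_left ℝ fun b => ?_
  have hint : Integrable (fun u : E d => ⟪a, u⟫ • u) (unifSphere d) := by
    refine integrable_unifSphere_of_bound hd (by fun_prop) ‖a‖ fun u hu => ?_
    simpa [norm_smul, hu] using norm_inner_le_norm (𝕜 := ℝ) a u
  rw [← integral_inner hint]
  -- Polarization reduces the claim to second moments.
  have : ∀ u : E d, ⟪b, ⟪a, u⟫ • u⟫ = (1 / 4) * (⟪a + b, u⟫ ^ 2 - ⟪a - b, u⟫ ^ 2) := by
    intro u
    rw [inner_smul_right, inner_add_left, inner_sub_left]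
    ring
  simp_rw [this]
  rw [integral_const_mul, integral_sub (integrable_inner_sq_unifSphere hd _)
    (integrable_inner_sq_unifSphere hd _), integral_inner_sq_unifSphere hd,
    integral_inner_sq_unifSphere hd, inner_smul_right, norm_add_sq_real, norm_sub_sq_real,
    real_inner_comm]
  ring


/-! ### Smooth functions -/

/-- `g` is differentiable on `U`, with `L`-Lipschitz gradient. -/
def IsSmoothOn {d : ℕ} (L : ℝ) (g : E d → ℝ) (U : Set (E d)) : Prop :=
  DifferentiableOn ℝ g U ∧
    ∀ x ∈ U, ∀ y ∈ U, ‖gradient g x - gradient g y‖ ≤ L * ‖x - y‖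

theorem IsSmoothOn.hasGradientAt {d : ℕ} {L : ℝ} {g : E d → ℝ} {U : Set (E d)}
    (h : IsSmoothOn L g U) (hU : IsOpen U) {x : E d} (hx : x ∈ U) :
    HasGradientAt g (gradient g x) x :=
  ((h.1 x hx).differentiableAt (hU.mem_nhds hx)).hasGradientAt

/-- The quadratic bound on the error of the linearization (with `L` in place of `L / 2`). -/
theorem IsSmoothOn.abs_sub_sub_inner_le {d : ℕ} {L : ℝ} {g : E d → ℝ} {U : Set (E d)}
    (hL : 0 ≤ L) (h : IsSmoothOn L g U) (hU : IsOpen U) {x y : E d} (hxy : segment ℝ x y ⊆ U) :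
    |g y - g x - ⟪gradient g x, y - x⟫| ≤ L * ‖y - x‖ ^ 2 := by
  have hx := hxy (left_mem_segment ℝ x y)
  -- Mean value inequality for `g` minus its linear part at `x`: on the segment the gradient moves
  -- by at most `L ‖y - x‖`.
  have := (convex_segment x y).norm_image_sub_le_of_norm_hasFDerivWithin_le'
    (f := g) (f' := fun z => InnerProductSpace.toDual ℝ (E d) (gradient g z))
    (φ := InnerProductSpace.toDual ℝ (E d) (gradient g x)) (C := L * ‖y - x‖)
    (fun z hz => (h.hasGradientAt hU (hxy hz)).hasFDerivAt.hasFDerivWithinAt)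
    (fun z hz => by
      rw [← map_sub, LinearIsometryEquiv.norm_map]
      refine (h.2 z (hxy hz) x hx).trans ?_
      gcongr
      obtain ⟨s, t, hs, ht, hst, rfl⟩ := hz
      have : s • x + t • y - x = t • (y - x) := by
        rw [eq_sub_of_add_eq hst]; module
      rw [this, norm_smul, Real.norm_of_nonneg ht]
      exact mul_le_of_le_one_left (norm_nonneg _) (by linarith))
    (left_mem_segment ℝ x y) (right_mem_segment ℝ x y)
  rw [InnerProductSpace.toDual_apply_apply, Real.norm_eq_abs] at this
  rw [pow_two, ← mul_assoc]
  exact this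

/-! ### Differentiation under the expectation. -/

section Objective

variable {d : ℕ} {Ξ : Type*} [MeasurableSpace Ξ] {F : E d → Ξ → ℝ} {P : Measure Ξ}
  {U : Set (E d)} {L : ℝ}

/-- A directional derivative is a pointwise limit of difference quotients, which are measurable in
`ξ`. -/
theorem measurable_gradient_inner (hF : Measurable (Function.uncurry F)) (hU : IsOpen U)
    (hs : ∀ ξ, IsSmoothOn L (fun x => F x ξ) U) {x : E d} (hx : x ∈ U) (v : E d) :
    Measurable fun ξ => ⟪v, gradient (fun x => F x ξ) x⟫ := by
  have hm : ∀ y, Measurable (F y) := fun y => hF.comp measurable_prodMk_left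
  refine measurable_of_tendsto_metrizable (f := fun (n : ℕ) ξ =>
    ((n : ℝ) + 1) * (F (x + ((n : ℝ) + 1)⁻¹ • v) ξ - F x ξ)) (fun n => ?_) ?_
  · exact ((hm _).sub (hm _)).const_mul _
  · rw [tendsto_pi_nhds]
    intro ξ
    have h1 := ((hs ξ).hasGradientAt hU hx).hasFDerivAt
    have h2 := h1.lim v (c := fun n : ℕ => (n : ℝ) + 1) (l := Filter.atTop) ?_
    · simpa [real_inner_comm] using h2
    · refine Filter.tendsto_atTop_mono (fun n => ?_) tendsto_natCast_atTop_atTop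
      rw [Real.norm_of_nonneg (by positivity)]
      linarith

/-- The linearization bound, read backwards, dominates the directional derivative by two values of
`F` and a constant, so no integrability of the gradient has to be assumed. -/
theorem integrable_gradient_inner [IsFiniteMeasure P] (hF : Measurable (Function.uncurry F))
    (hL : 0 ≤ L) (hU : IsOpen U) (hi : ∀ x ∈ U, Integrable (F x) P)
    (hs : ∀ ξ, IsSmoothOn L (fun x => F x ξ) U) {x : E d} (hx : x ∈ U) (v : E d) :
    Integrable (fun ξ => ⟪v, gradient (fun x => F x ξ) x⟫) P := by
  obtain ⟨r, hr, hrU⟩ := Metric.isOpen_iff.1 hU x hx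
  set c : ℝ := r / (2 * (‖v‖ + 1)) with hc
  have hv : 0 < ‖v‖ + 1 := by positivity
  have hcpos : 0 < c := by positivity
  have hball : x + c • v ∈ Metric.ball x r := by
    rw [mem_ball_iff_norm, add_sub_cancel_left, norm_smul, Real.norm_of_nonneg hcpos.le, hc,
      div_mul_eq_mul_div, div_lt_iff₀ (by positivity)]
    nlinarith [norm_nonneg v]
  have hseg : segment ℝ x (x + c • v) ⊆ U :=
    ((convex_ball x r).segment_subset (Metric.mem_ball_self hr) hball).trans hrU
  have hint : Integrable (fun ξ => c⁻¹ * (|F (x + c • v) ξ| + |F x ξ| + L * ‖c • v‖ ^ 2)) P :=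
    (((hi _ (hrU hball)).abs.add (hi x hx).abs).add (integrable_const _)).const_mul _
  refine hint.mono' (measurable_gradient_inner hF hU hs hx v).aestronglyMeasurable
    (Filter.Eventually.of_forall fun ξ => ?_)
  have := (hs ξ).abs_sub_sub_inner_le hL hU hseg
  rw [add_sub_cancel_left, inner_smul_right, real_inner_comm] at this
  rw [Real.norm_eq_abs, ← div_eq_inv_mul, le_div_iff₀ hcpos, ← abs_of_pos hcpos, ← abs_mul,
    abs_of_pos hcpos, mul_comm]
  have h3 := abs_sub_abs_le_abs_sub (c * ⟪v, gradient (fun x => F x ξ) x⟫)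
    (F (x + c • v) ξ - F x ξ)
  rw [abs_sub_comm (c * _)] at h3
  have h4 := abs_sub (F (x + c • v) ξ) (F x ξ)
  linarith

theorem integrable_gradient [IsFiniteMeasure P] (hF : Measurable (Function.uncurry F))
    (hL : 0 ≤ L) (hU : IsOpen U) (hi : ∀ x ∈ U, Integrable (F x) P)
    (hs : ∀ ξ, IsSmoothOn L (fun x => F x ξ) U) {x : E d} (hx : x ∈ U) :
    Integrable (fun ξ => gradient (fun x => F x ξ) x) P := by
  set b := EuclideanSpace.basisFun (Fin d) ℝ
  have : (fun ξ => gradient (fun x => F x ξ) x) =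
      fun ξ => ∑ i, ⟪b i, gradient (fun x => F x ξ) x⟫ • b i := by
    ext1 ξ
    exact (b.sum_repr' _).symm
  rw [this]
  exact integrable_finsetSum _ fun i _ =>
    (integrable_gradient_inner hF hL hU hi hs hx (b i)).smul_const _

theorem hasGradientAt_objective [IsFiniteMeasure P] (hF : Measurable (Function.uncurry F))
    (hL : 0 ≤ L) (hU : IsOpen U) (hi : ∀ x ∈ U, Integrable (F x) P)
    (hs : ∀ ξ, IsSmoothOn L (fun x => F x ξ) U) {x : E d} (hx : x ∈ U) :
    HasGradientAt (objective F P) (∫ ξ, gradient (fun x => F x ξ) x ∂P) x := by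
  obtain ⟨r, hr, hrU⟩ := Metric.isOpen_iff.1 hU x hx
  have hG := integrable_gradient hF hL hU hi hs hx
  have hm : ∀ y, Measurable (F y) := fun y => hF.comp measurable_prodMk_left
  have := hasFDerivAt_integral_of_dominated_of_fderiv_le (μ := P) (F := F) (x₀ := x)
    (s := Metric.ball x r)
    (F' := fun y ξ => InnerProductSpace.toDual ℝ (E d) (gradient (fun x => F x ξ) y))
    -- Integrability at the centre and the Lipschitz bound control the gradients on the whole ball.
    (bound := fun ξ => ‖gradient (fun x => F x ξ) x‖ + L * r) (Metric.ball_mem_nhds x hr)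
    (Filter.Eventually.of_forall fun y => (hm y).aestronglyMeasurable) (hi x hx)
    ((InnerProductSpace.toDual ℝ (E d)).continuous.comp_aestronglyMeasurable
      hG.aestronglyMeasurable)
    (Filter.Eventually.of_forall fun ξ y hy => by
      rw [LinearIsometryEquiv.norm_map]
      have h1 := (hs ξ).2 y (hrU hy) x hx
      have h2 := norm_sub_norm_le (gradient (fun x => F x ξ) y) (gradient (fun x => F x ξ) x)
      have h3 : L * ‖y - x‖ ≤ L * r := by
        gcongr
        exact (mem_ball_iff_norm.1 hy).le
      linarith)
    (hG.norm.add (integrable_const _))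
    (Filter.Eventually.of_forall fun ξ y hy => ((hs ξ).hasGradientAt hU (hrU hy)).hasFDerivAt)
  rw [hasGradientAt_iff_hasFDerivAt]
  refine this.congr_fderiv ?_
  have hG' : Integrable (fun ξ =>
      InnerProductSpace.toDual ℝ (E d) (gradient (fun x => F x ξ) x)) P :=
    hG.mono ((InnerProductSpace.toDual ℝ (E d)).continuous.comp_aestronglyMeasurable
      hG.aestronglyMeasurable) (Filter.Eventually.of_forall fun ξ => by
        rw [LinearIsometryEquiv.norm_map])
  ext v
  rw [ContinuousLinearMap.integral_apply hG', InnerProductSpace.toDual_apply_apply,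
    real_inner_comm, ← integral_inner hG]
  simp

theorem isSmoothOn_objective [IsProbabilityMeasure P] (hF : Measurable (Function.uncurry F))
    (hL : 0 ≤ L) (hU : IsOpen U) (hi : ∀ x ∈ U, Integrable (F x) P)
    (hs : ∀ ξ, IsSmoothOn L (fun x => F x ξ) U) : IsSmoothOn L (objective F P) U := by
  refine ⟨fun x hx =>
    (hasGradientAt_objective hF hL hU hi hs hx).differentiableAt.differentiableWithinAt,
    fun x hx y hy => ?_⟩
  rw [(hasGradientAt_objective hF hL hU hi hs hx).gradient,
    (hasGradientAt_objective hF hL hU hi hs hy).gradient,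
    ← integral_sub (integrable_gradient hF hL hU hi hs hx) (integrable_gradient hF hL hU hi hs hy)]
  simpa using norm_integral_le_of_norm_le_const (μ := P)
    (Filter.Eventually.of_forall fun ξ => (hs ξ).2 x hx y hy)

end Objective

/-! ### The Frank-Wolfe gap -/

theorem continuousOn_gradient_of_isSmoothOn {d : ℕ} {L : ℝ} {g : E d → ℝ} {U : Set (E d)}
    (hL : 0 ≤ L) (h : IsSmoothOn L g U) : ContinuousOn (gradient g) U :=
  (LipschitzOnWith.of_dist_le_mul (K := ⟨L, hL⟩) fun x hx y hy => by
    rw [dist_eq_norm, dist_eq_norm]; exact h.2 x hx y hy).continuousOn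

theorem continuous_fwGap_restrict {d : ℕ} {X : Set (E d)} (hX : IsCompact X) {f : E d → ℝ}
    (hf : ContinuousOn (gradient f) X) : Continuous (X.domRestrict (fwGap X f)) := by
  have hf' : Continuous (fun x : X => gradient f x) := continuousOn_iff_continuous_domRestrict.1 hf
  exact hX.continuous_sSup (f := fun (x : X) (w : E d) => ⟪w - x, -gradient f x⟫) (by
    change Continuous fun p : X × E d => ⟪p.2 - p.1, -gradient f p.1⟫
    have := hf'.comp (continuous_fst (Y := E d))
    exact (by fun_prop : Continuous fun p : X × E d => p.2 - (p.1 : E d)).inner this.neg)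

theorem exists_inner_eq_fwGap {d : ℕ} {X : Set (E d)} (hX : IsCompact X) (hne : X.Nonempty)
    (f : E d → ℝ) (x : E d) : ∃ w ∈ X, ⟪w - x, -gradient f x⟫ = fwGap X f x :=
  (hX.image (f := fun w => ⟪w - x, -gradient f x⟫) (by fun_prop)).sSup_mem (hne.image _)


/-! ### Second moments of sums of independent vectors -/

theorem lintegral_enorm_sq_eq {V : Type*} [NormedAddCommGroup V] {β : Type*}
    [MeasurableSpace β] {Q : Measure β} {h : β → V}
    (hh : MemLp h 2 Q) : ∫⁻ s, ‖h s‖ₑ ^ 2 ∂Q = ENNReal.ofReal (∫ s, ‖h s‖ ^ 2 ∂Q) := by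
  rw [ofReal_integral_eq_lintegral_ofReal ((memLp_two_iff_integrable_sq_norm hh.1).1 hh)
    (Filter.Eventually.of_forall fun s => by positivity)]
  refine lintegral_congr fun s => ?_
  rw [ENNReal.ofReal_pow (norm_nonneg _), ofReal_norm]

/-- Jensen's inequality, as nonnegativity of the variance of `‖g‖`. Finiteness of the right-hand
side gives integrability. For `K < 0` both `ENNReal.ofReal K` and `√K` are zero. -/
theorem integral_norm_le_sqrt_of_lintegral_le {V : Type*} [NormedAddCommGroup V]
    [MeasurableSpace V] [BorelSpace V] [SecondCountableTopology V] {Ω : Type*}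
    [MeasurableSpace Ω] {μ : Measure Ω} [IsProbabilityMeasure μ] {g : Ω → V}
    (hg : Measurable g) {K : ℝ}
    (h : ∫⁻ ω, ‖g ω‖ₑ ^ 2 ∂μ ≤ ENNReal.ofReal K) :
    Integrable g μ ∧ ∫ ω, ‖g ω‖ ∂μ ≤ √K := by
  have h1 : MemLp g 2 μ := by
    refine ⟨hg.aestronglyMeasurable, ?_⟩
    rw [eLpNorm_lt_top_iff_lintegral_rpow_enorm_lt_top two_ne_zero ENNReal.ofNat_ne_top]
    simpa using h.trans_lt ENNReal.ofReal_lt_top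
  have hi := h1.integrable one_le_two
  refine ⟨hi, ?_⟩
  have hsq := (memLp_two_iff_integrable_sq_norm h1.1).1 h1
  rcases le_or_gt 0 K with hK | hK
  · have h2 : ∫ ω, ‖g ω‖ ^ 2 ∂μ ≤ K := by
      rwa [lintegral_enorm_sq_eq h1, ENNReal.ofReal_le_ofReal_iff hK] at h
    refine Real.le_sqrt_of_sq_le (le_trans ?_ h2)
    have h3 := variance_nonneg (fun ω => ‖g ω‖) μ
    rw [variance_eq_sub h1.norm] at h3
    simpa using h3
  · rw [ENNReal.ofReal_of_nonpos hK.le, nonpos_iff_eq_zero, lintegral_enorm_sq_eq h1,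
      ENNReal.ofReal_eq_zero] at h
    have h3 := variance_nonneg (fun ω => ‖g ω‖) μ
    rw [variance_eq_sub h1.norm] at h3
    simp only [Pi.pow_apply] at h3
    rw [Real.sqrt_eq_zero_of_nonpos hK.le]
    nlinarith

section SecondMoment

variable {V : Type*} [NormedAddCommGroup V] [InnerProductSpace ℝ V] [CompleteSpace V]

theorem integral_norm_add_sq_of_integral_eq_zero {β : Type*} [MeasurableSpace β] {Q : Measure β}
    [IsProbabilityMeasure Q] {h : β → V} (hh : MemLp h 2 Q) (h0 : ∫ s, h s ∂Q = 0) (x : V) :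
    ∫ s, ‖x + h s‖ ^ 2 ∂Q = ‖x‖ ^ 2 + ∫ s, ‖h s‖ ^ 2 ∂Q := by
  have hi := hh.integrable one_le_two
  have h2 := (memLp_two_iff_integrable_sq_norm hh.1).1 hh
  simp_rw [norm_add_sq_real]
  have hx : Integrable (fun s => 2 * ⟪x, h s⟫) Q := (hi.const_inner x).const_mul 2
  have hc : Integrable (fun s => ‖x‖ ^ 2 + 2 * ⟪x, h s⟫) Q := (integrable_const _).add hx
  rw [integral_add hc h2, integral_add (integrable_const _) hx, integral_const_mul,
    integral_inner hi, h0]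
  simp

theorem lintegral_enorm_add_sq_of_integral_eq_zero {β : Type*} [MeasurableSpace β]
    {Q : Measure β} [IsProbabilityMeasure Q] {h : β → V} (hh : MemLp h 2 Q)
    (h0 : ∫ s, h s ∂Q = 0) (x : V) :
    ∫⁻ s, ‖x + h s‖ₑ ^ 2 ∂Q = ‖x‖ₑ ^ 2 + ∫⁻ s, ‖h s‖ₑ ^ 2 ∂Q := by
  have h1 : MemLp (fun s => x + h s) 2 Q := (memLp_const x).add hh
  rw [lintegral_enorm_sq_eq h1, lintegral_enorm_sq_eq hh,
    integral_norm_add_sq_of_integral_eq_zero hh h0,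
    ENNReal.ofReal_add (by positivity) (integral_nonneg fun s => by positivity),
    ENNReal.ofReal_pow (norm_nonneg _), ofReal_norm]

/-- The mean minimizes the second moment. -/
theorem lintegral_enorm_sub_integral_sq_le {β : Type*} [MeasurableSpace β] {Q : Measure β}
    [IsProbabilityMeasure Q] {h : β → V} (hh : MemLp h 2 Q) (c : V) :
    ∫⁻ s, ‖h s - ∫ s', h s' ∂Q‖ₑ ^ 2 ∂Q ≤ ∫⁻ s, ‖h s - c‖ₑ ^ 2 ∂Q := by
  have hi := hh.integrable one_le_two
  have h1 : MemLp (fun s => h s - ∫ s', h s' ∂Q) 2 Q := hh.sub (memLp_const _)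
  have := lintegral_enorm_add_sq_of_integral_eq_zero h1
    (by rw [integral_sub hi (integrable_const _)]; simp) ((∫ s', h s' ∂Q) - c)
  simp only [add_comm (_ - c), sub_add_sub_cancel] at this
  rw [this]
  exact le_add_self

variable [MeasurableSpace V] [BorelSpace V] [SecondCountableTopology V]
  {Ω α β : Type*} [MeasurableSpace Ω] {μ : Measure Ω} [IsProbabilityMeasure μ]
  [MeasurableSpace α] [MeasurableSpace β]

/-- By independence the joint law is a product, and for fixed `a` the cross term vanishes because `h
a` is centred. The set `G` confines `A` to the values (feasible points, in the applications) where
the moment bounds hold. -/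
theorem lintegral_enorm_add_sq_le_of_indepFun {A : Ω → α} {S : Ω → β} (hA : Measurable A)
    (hS : Measurable S) (hind : IndepFun A S μ) {e : α → V} (he : Measurable e)
    {h : α → β → V} (hh : Measurable (Function.uncurry h)) {G : Set α} (hG : MeasurableSet G)
    (hAG : ∀ ω, A ω ∈ G) {K : ℝ≥0∞} (hL2 : ∀ a ∈ G, MemLp (h a) 2 (μ.map S))
    (h0 : ∀ a ∈ G, ∫ s, h a s ∂μ.map S = 0) (hK : ∀ a ∈ G, ∫⁻ s, ‖h a s‖ₑ ^ 2 ∂μ.map S ≤ K) :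
    ∫⁻ ω, ‖e (A ω) + h (A ω) (S ω)‖ₑ ^ 2 ∂μ ≤ ∫⁻ ω, ‖e (A ω)‖ₑ ^ 2 ∂μ + K := by
  have : IsProbabilityMeasure (μ.map S) := Measure.isProbabilityMeasure_map hS.aemeasurable
  have : IsProbabilityMeasure (μ.map A) := Measure.isProbabilityMeasure_map hA.aemeasurable
  have hm : Measurable fun p : α × β => ‖e p.1 + h p.1 p.2‖ₑ ^ 2 :=
    ((he.comp measurable_fst).add hh).enorm.pow_const 2
  have hlaw := (indepFun_iff_map_prod_eq_prod_map_map hA.aemeasurable hS.aemeasurable).1 hind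
  calc ∫⁻ ω, ‖e (A ω) + h (A ω) (S ω)‖ₑ ^ 2 ∂μ
      = ∫⁻ p, ‖e p.1 + h p.1 p.2‖ₑ ^ 2 ∂μ.map fun ω => (A ω, S ω) :=
        (lintegral_map hm (hA.prodMk hS)).symm
    _ = ∫⁻ a, ∫⁻ s, ‖e a + h a s‖ₑ ^ 2 ∂μ.map S ∂μ.map A := by
        rw [hlaw, lintegral_prod _ hm.aemeasurable]
    _ ≤ ∫⁻ a, (‖e a‖ₑ ^ 2 + K) ∂μ.map A := by
        refine lintegral_mono_ae ?_
        filter_upwards [(ae_map_iff hA.aemeasurable hG).2 (Filter.Eventually.of_forall hAG)]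
          with a ha
        rw [lintegral_enorm_add_sq_of_integral_eq_zero (hL2 a ha) (h0 a ha)]
        gcongr
        exact hK a ha
    _ = ∫⁻ ω, ‖e (A ω)‖ₑ ^ 2 ∂μ + K := by
        rw [lintegral_add_right _ measurable_const, lintegral_map (he.enorm.pow_const 2) hA]
        simp

/-- Adding to `e` a sum of `b` centred terms, each driven by a fresh independent sample,
increases the second moment by at most `b` times that of a term. -/
theorem lintegral_enorm_add_sum_sq_le {A : Ω → α} {S : ℕ → Ω → β} {Q : Measure β}
    (m : ℕ → MeasurableSpace Ω) (hm : ∀ j, m j ≤ ‹MeasurableSpace Ω›)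
    (hA : ∀ j, Measurable[m j] A)
    (hSm : ∀ i j, i < j → Measurable[m j] (S i)) (hS : ∀ j, Measurable (S j))
    (hind : ∀ j, Indep (m j) (MeasurableSpace.comap (S j) inferInstance) μ)
    (hQ : ∀ j, μ.map (S j) = Q) {e : α → V} (he : Measurable e)
    {h : α → β → V} (hh : Measurable (Function.uncurry h)) {G : Set α} (hG : MeasurableSet G)
    (hAG : ∀ ω, A ω ∈ G) {K : ℝ≥0∞} (hL2 : ∀ a ∈ G, MemLp (h a) 2 Q)
    (h0 : ∀ a ∈ G, ∫ s, h a s ∂Q = 0) (hK : ∀ a ∈ G, ∫⁻ s, ‖h a s‖ₑ ^ 2 ∂Q ≤ K) (b : ℕ) :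
    ∫⁻ ω, ‖e (A ω) + ∑ i ∈ Finset.range b, h (A ω) (S i ω)‖ₑ ^ 2 ∂μ ≤
      ∫⁻ ω, ‖e (A ω)‖ₑ ^ 2 ∂μ + b * K := by
  induction b with
  | zero => simp
  | succ j ih =>
    -- The partial sum joins the past, so that the next sample is independent of everything it is
    -- added to.
    let A' : Ω → α × V := fun ω => (A ω, ∑ i ∈ Finset.range j, h (A ω) (S i ω))
    have hA' : Measurable[m j] A' := by
      refine (hA j).prodMk ?_
      refine Finset.measurable_fun_sum _ fun i hi => ?_
      exact hh.comp ((hA j).prodMk (hSm i j (Finset.mem_range.1 hi)))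
    have hind' : IndepFun A' (S j) μ :=
      indep_of_indep_of_le_left (hind j) hA'.comap_le
    have := lintegral_enorm_add_sq_le_of_indepFun (hA'.mono (hm j) le_rfl) (hS j) hind'
      (e := fun a => e a.1 + a.2) (by fun_prop) (h := fun a s => h a.1 s)
      (hh.comp ((measurable_fst.comp measurable_fst).prodMk measurable_snd))
      (G := Prod.fst ⁻¹' G) (measurable_fst hG) hAG (K := K)
      (fun a ha => by rw [hQ]; exact hL2 _ ha) (fun a ha => by rw [hQ]; exact h0 _ ha)
      (fun a ha => by rw [hQ]; exact hK _ ha)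
    simp only [Finset.sum_range_succ, ← add_assoc]
    refine this.trans ((add_le_add_left ih K).trans (le_of_eq ?_))
    push_cast
    ring

/-- Averaging scales each second moment by `1 / b²`, and there are `b` of them. -/
theorem lintegral_enorm_add_average_sq_le {A : Ω → α} {S : ℕ → Ω → β} {Q : Measure β}
    (m : ℕ → MeasurableSpace Ω) (hm : ∀ j, m j ≤ ‹MeasurableSpace Ω›)
    (hA : ∀ j, Measurable[m j] A)
    (hSm : ∀ i j, i < j → Measurable[m j] (S i)) (hS : ∀ j, Measurable (S j))
    (hind : ∀ j, Indep (m j) (MeasurableSpace.comap (S j) inferInstance) μ)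
    (hQ : ∀ j, μ.map (S j) = Q) {e : α → V} (he : Measurable e)
    {h : α → β → V} (hh : Measurable (Function.uncurry h)) {G : Set α} (hG : MeasurableSet G)
    (hAG : ∀ ω, A ω ∈ G) {K : ℝ} (hL2 : ∀ a ∈ G, MemLp (h a) 2 Q)
    (h0 : ∀ a ∈ G, ∫ s, h a s ∂Q = 0)
    (hK : ∀ a ∈ G, ∫⁻ s, ‖h a s‖ₑ ^ 2 ∂Q ≤ ENNReal.ofReal K) {b : ℕ} (hb : b ≠ 0) :
    ∫⁻ ω, ‖e (A ω) + (1 / (b : ℝ)) • ∑ i ∈ Finset.range b, h (A ω) (S i ω)‖ₑ ^ 2 ∂μ ≤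
      ∫⁻ ω, ‖e (A ω)‖ₑ ^ 2 ∂μ + ENNReal.ofReal (K / b) := by
  have hb' : (0 : ℝ) < b := by positivity
  have := lintegral_enorm_add_sum_sq_le m hm hA hSm hS hind hQ he
    (h := fun a s => (1 / (b : ℝ)) • h a s) (hh.const_smul (1 / (b : ℝ))) hG hAG
    (K := ENNReal.ofReal (K / b ^ 2)) (fun a ha => (hL2 a ha).const_smul (1 / (b : ℝ)))
    (fun a ha => by rw [integral_smul, h0 a ha, smul_zero])
    (fun a ha => by
      simp only [enorm_smul, mul_pow]
      rw [lintegral_const_mul' _ _ (by simp [← ofReal_norm])]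
      refine (mul_le_mul_right (hK a ha) _).trans (le_of_eq ?_)
      rw [← ofReal_norm, ← ENNReal.ofReal_pow (norm_nonneg _), ← ENNReal.ofReal_mul (by positivity),
        Real.norm_of_nonneg (by positivity)]
      congr 1
      field_simp) b
  simp only [← Finset.smul_sum] at this
  refine this.trans (le_of_eq ?_)
  rw [← ENNReal.ofReal_natCast, ← ENNReal.ofReal_mul hb'.le]
  congr 2
  field_simp

end SecondMoment


/-! ### The gradient estimator -/

/-- The gradient estimator as a function of the point and the sample `(ξ, u)`. -/
noncomputable def estimator {d : ℕ} {Ξ : Type*} (F : E d → Ξ → ℝ) (β : ℝ) (z : E d)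
    (s : Ξ × E d) : E d :=
  (uniGE (oracle fun x => F x s.1) β s.2 z).value

theorem estimator_eq {d : ℕ} {Ξ : Type*} (F : E d → Ξ → ℝ) (β : ℝ) (z : E d) (s : Ξ × E d) :
    estimator F β z s = ((d : ℝ) * (F (z + β • s.2) s.1 - F z s.1) / β) • s.2 := rfl

/-- The mean of the gradient estimator. -/
noncomputable def meanEstimator {d : ℕ} {Ξ : Type*} [MeasurableSpace Ξ] (F : E d → Ξ → ℝ)
    (P : Measure Ξ) (β : ℝ) (z : E d) : E d :=
  ∫ s, estimator F β z s ∂P.prod (unifSphere d)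

/-- Each estimator is `d ⟪∇F, u⟫ u` up to an error `L d β`; then `(a + b)² ≤ 2a² + 2b²`, with `b` at
most `2 L d β`. The inner product with `u` is kept so that averaging over the sphere can later gain
a factor `1 / d`. -/
theorem norm_estimator_sub_sq_le {d : ℕ} {Ξ : Type*} {F : E d → Ξ → ℝ} {β L : ℝ}
    (hL : 0 ≤ L) (hβ : 0 < β) {U : Set (E d)} (hU : IsOpen U)
    {ξ : Ξ} (hs : IsSmoothOn L (fun x => F x ξ) U) {z z' u : E d} (hu : ‖u‖ = 1)
    (hz : segment ℝ z (z + β • u) ⊆ U) (hz' : segment ℝ z' (z' + β • u) ⊆ U) :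
    ‖estimator F β z (ξ, u) - estimator F β z' (ξ, u)‖ ^ 2 ≤ 2 * (d : ℝ) ^ 2 *
      ⟪gradient (fun x => F x ξ) z - gradient (fun x => F x ξ) z', u⟫ ^ 2 +
        8 * L ^ 2 * (d * β) ^ 2 := by
  have h1 := hs.abs_sub_sub_inner_le hL hU hz
  have h2 := hs.abs_sub_sub_inner_le hL hU hz'
  rw [add_sub_cancel_left, inner_smul_right, norm_smul, hu, Real.norm_of_nonneg hβ.le] at h1 h2
  simp only [estimator_eq]
  rw [← sub_smul, norm_smul, hu, mul_one, Real.norm_eq_abs, sq_abs, inner_sub_left]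
  generalize ⟪gradient (fun x => F x ξ) z, u⟫ = a at *
  generalize ⟪gradient (fun x => F x ξ) z', u⟫ = a' at *
  generalize hr : F (z + β • u) ξ - F z ξ - β * a = r at *
  generalize hr' : F (z' + β • u) ξ - F z' ξ - β * a' = r' at *
  have h3 : (d : ℝ) * (F (z + β • u) ξ - F z ξ) / β - d * (F (z' + β • u) ξ - F z' ξ) / β =
      d * (a - a') + d / β * (r - r') := by
    rw [← hr, ← hr']
    field_simp
    ring
  have h4 : |d / β * (r - r')| ≤ 2 * (L * (d * β)) := by
    rw [abs_mul, abs_of_nonneg (by positivity)]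
    refine (mul_le_mul_of_nonneg_left ((abs_sub r r').trans (add_le_add h1 h2))
      (by positivity)).trans (le_of_eq ?_)
    field_simp
    ring
  have h5 := sq_le_sq' (by linarith [neg_abs_le (d / β * (r - r'))])
    ((le_abs_self _).trans h4)
  rw [h3]
  nlinarith [sq_nonneg (d * (a - a') - d / β * (r - r'))]

section Estimator

variable {d : ℕ} {Ξ : Type*} [MeasurableSpace Ξ] {X : Set (E d)} {F : E d → Ξ → ℝ}
  {P : Measure Ξ} {β L D Δ σ : ℝ}

theorem measurable_estimator (hF : Measurable (Function.uncurry F)) (β : ℝ) :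
    Measurable (Function.uncurry (estimator F β)) := by
  have h : Function.uncurry (estimator F β) = fun p : E d × (Ξ × E d) =>
      ((d : ℝ) * (Function.uncurry F (p.1 + β • p.2.2, p.2.1) - Function.uncurry F (p.1, p.2.1)) / β)
        • p.2.2 := rfl
  rw [h]
  fun_prop

theorem measurable_estimator_comp (hF : Measurable (Function.uncurry F)) (β : ℝ) {Ω : Type*}
    {mΩ : MeasurableSpace Ω} {Z : Ω → E d} {S : Ω → Ξ × E d} (hZ : Measurable Z)
    (hS : Measurable S) : Measurable fun ω => estimator F β (Z ω) (S ω) :=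
  Measurable.comp (g := Function.uncurry (estimator F β)) (f := fun ω => (Z ω, S ω))
    (measurable_estimator hF β) (hZ.prodMk hS)

theorem measurable_meanEstimator [IsProbabilityMeasure P] (hd : 1 ≤ d)
    (hF : Measurable (Function.uncurry F)) (β : ℝ) : Measurable (meanEstimator F P β) := by
  have := isProbabilityMeasure_unifSphere hd
  exact ((measurable_estimator hF β).stronglyMeasurable.integral_prod_right').measurable

theorem Assumptions.exists_isSmoothOn [IsProbabilityMeasure P]
    (h : Assumptions X F P β L D Δ σ) (hL : 0 ≤ L) (hβ : 0 ≤ β) :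
    ∃ U : Set (E d), IsOpen U ∧ X ⊆ U ∧
      (∀ z ∈ X, ∀ u, ‖u‖ = 1 → segment ℝ z (z + β • u) ⊆ U) ∧
      (∀ x ∈ U, Integrable (F x) P) ∧ (∀ ξ, IsSmoothOn L (fun x => F x ξ) U) ∧
      IsSmoothOn L (objective F P) U := by
  obtain ⟨U, hU, hXU, hi, hs⟩ := h.smooth
  refine ⟨U, hU, (Metric.self_subset_cthickening X).trans hXU, fun z hz u hu => ?_, hi, hs,
    isSmoothOn_objective h.measurable hL hU hi hs⟩
  refine ((convex_closedBall z β).segment_subset (Metric.mem_closedBall_self hβ) ?_).trans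
    ((Metric.closedBall_subset_cthickening hz β).trans hXU)
  simp [norm_smul, hu, abs_of_nonneg hβ]

theorem Assumptions.memLp_estimator [IsProbabilityMeasure P] (h : Assumptions X F P β L D Δ σ)
    (hd : 1 ≤ d) {z : E d} (hz : z ∈ X) :
    MemLp (estimator F β z) 2 (P.prod (unifSphere d)) := by
  have := isProbabilityMeasure_unifSphere hd
  have hm : Measurable (estimator F β z) :=
    (measurable_estimator h.measurable β).of_uncurry_left
  -- All that matters about `∇f_β(z)` is that it does not depend on the sample.
  obtain ⟨c, hc⟩ : ∃ c, ∫⁻ s, ‖estimator F β z s - c‖ₑ ^ 2 ∂P.prod (unifSphere d) ≤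
      ENNReal.ofReal (σ ^ 2) := ⟨_, h.variance z hz⟩
  have h1 : MemLp (fun s => estimator F β z s - c) 2 (P.prod (unifSphere d)) := by
    refine ⟨(hm.sub_const c).aestronglyMeasurable, ?_⟩
    rw [eLpNorm_lt_top_iff_lintegral_rpow_enorm_lt_top two_ne_zero ENNReal.ofNat_ne_top]
    simpa using hc.trans_lt ENNReal.ofReal_lt_top
  have h2 : estimator F β z = (fun s => estimator F β z s - c) + fun _ => c := by
    ext1 s
    exact (sub_add_cancel _ _).symm
  rw [h2]
  exact h1.add (memLp_const c)

/-- Recentring at the true mean can only lower the second moment. -/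
theorem Assumptions.lintegral_estimator_sub_mean_le [IsProbabilityMeasure P]
    (h : Assumptions X F P β L D Δ σ) (hd : 1 ≤ d) {z : E d} (hz : z ∈ X) :
    ∫⁻ s, ‖estimator F β z s - meanEstimator F P β z‖ₑ ^ 2 ∂P.prod (unifSphere d)
      ≤ ENNReal.ofReal (σ ^ 2) := by
  have := isProbabilityMeasure_unifSphere hd
  exact (lintegral_enorm_sub_integral_sq_le (h.memLp_estimator hd hz) _).trans (h.variance z hz)

/-- The bias of the gradient estimator. -/
theorem Assumptions.norm_meanEstimator_sub_gradient_le [IsProbabilityMeasure P]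
    (h : Assumptions X F P β L D Δ σ) (hd : 1 ≤ d) (hL : 0 ≤ L) (hβ : 0 < β) {z : E d}
    (hz : z ∈ X) : ‖meanEstimator F P β z - gradient (objective F P) z‖ ≤ L * (d * β) := by
  have := isProbabilityMeasure_unifSphere hd
  obtain ⟨U, hU, hXU, hseg, hi, -, hf⟩ := h.exists_isSmoothOn hL hβ.le
  set f := objective F P
  set g := gradient f z
  have hint := (h.memLp_estimator hd hz).integrable one_le_two
  have hd' : (0 : ℝ) < d := by positivity
  have hg : Integrable (fun u : E d => (d : ℝ) • ⟪g, u⟫ • u) (unifSphere d) := by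
    have hm : AEStronglyMeasurable (fun u : E d => ⟪g, u⟫ • u) (unifSphere d) := by fun_prop
    refine Integrable.smul (d : ℝ) (integrable_unifSphere_of_bound hd hm ‖g‖ fun u hu => ?_)
    simpa [norm_smul, hu] using norm_inner_le_norm (𝕜 := ℝ) g u
  -- With the gradient itself written as a spherical average, the bias is an average of
  -- linearization errors of `f`, each at most `(d / β) L β²`.
  have hgrad : g = ∫ u, (d : ℝ) • ⟪g, u⟫ • u ∂unifSphere d := by
    rw [integral_smul, integral_inner_smul_unifSphere hd, smul_smul, mul_inv_cancel₀ hd'.ne',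
      one_smul]
  rw [meanEstimator, integral_prod_symm _ hint, hgrad, ← integral_sub hint.integral_prod_right hg]
  refine (norm_integral_le_of_norm_le_const (C := L * (d * β)) ?_).trans (by simp)
  filter_upwards [ae_norm_eq_one_unifSphere d] with u hu
  have hsegu := hseg z hz u hu
  have h1 : ∫ ξ, estimator F β z (ξ, u) ∂P = ((d : ℝ) * (f (z + β • u) - f z) / β) • u := by
    simp only [estimator_eq]
    rw [integral_smul_const, integral_div, integral_const_mul,
      integral_sub (hi _ (hsegu (right_mem_segment ℝ _ _))) (hi _ (hXU hz))]
    rfl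
  have h2 := hf.abs_sub_sub_inner_le hL hU hsegu
  rw [add_sub_cancel_left, inner_smul_right, norm_smul, hu, Real.norm_of_nonneg hβ.le] at h2
  rw [h1, smul_smul, ← sub_smul, norm_smul, hu, mul_one, Real.norm_eq_abs]
  have h3 : (d : ℝ) * (f (z + β • u) - f z) / β - d * ⟪g, u⟫ =
      d / β * (f (z + β • u) - f z - β * ⟪g, u⟫) := by
    field_simp
  rw [h3, abs_mul, abs_of_pos (by positivity)]
  refine (mul_le_mul_of_nonneg_left h2 (by positivity)).trans (le_of_eq ?_)
  field_simp

/-- The second moment of the correction terms of the gradient estimate. -/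
theorem Assumptions.lintegral_estimator_sub_le [IsProbabilityMeasure P]
    (h : Assumptions X F P β L D Δ σ) (hd : 1 ≤ d) (hL : 0 ≤ L) (hβ : 0 < β) {z z' : E d}
    (hz : z ∈ X) (hz' : z' ∈ X) :
    ∫⁻ s, ‖estimator F β z s - estimator F β z' s‖ₑ ^ 2 ∂P.prod (unifSphere d)
      ≤ ENNReal.ofReal (2 * d * L ^ 2 * ‖z - z'‖ ^ 2 + 8 * L ^ 2 * (d * β) ^ 2) := by
  have := isProbabilityMeasure_unifSphere hd
  obtain ⟨U, hU, hXU, hseg, -, hs, -⟩ := h.exists_isSmoothOn hL hβ.le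
  have hd' : (0 : ℝ) < d := by positivity
  have hm : ∀ z, Measurable (estimator F β z) := fun z =>
    (measurable_estimator h.measurable β).of_uncurry_left
  have hm2 : Measurable fun s => ‖estimator F β z s - estimator F β z' s‖ₑ ^ 2 :=
    ((hm z).sub (hm z')).enorm.pow_const 2
  rw [lintegral_prod _ hm2.aemeasurable]
  refine (lintegral_mono (g := fun _ => ENNReal.ofReal
    (2 * d * L ^ 2 * ‖z - z'‖ ^ 2 + 8 * L ^ 2 * (d * β) ^ 2)) fun ξ => ?_).trans (by simp)
  set a := gradient (fun x => F x ξ) z - gradient (fun x => F x ξ) z' with ha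
  have hint : Integrable (fun u => 2 * (d : ℝ) ^ 2 * ⟪a, u⟫ ^ 2 + 8 * L ^ 2 * (d * β) ^ 2)
      (unifSphere d) :=
    ((integrable_inner_sq_unifSphere hd a).const_mul _).add (integrable_const _)
  calc ∫⁻ u, ‖estimator F β z (ξ, u) - estimator F β z' (ξ, u)‖ₑ ^ 2 ∂unifSphere d
      ≤ ∫⁻ u, ENNReal.ofReal (2 * (d : ℝ) ^ 2 * ⟪a, u⟫ ^ 2 + 8 * L ^ 2 * (d * β) ^ 2)
          ∂unifSphere d := by
        refine lintegral_mono_ae ?_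
        filter_upwards [ae_norm_eq_one_unifSphere d] with u hu
        rw [← ofReal_norm, ← ENNReal.ofReal_pow (norm_nonneg _)]
        refine ENNReal.ofReal_le_ofReal ?_
        exact norm_estimator_sub_sq_le hL hβ hU (hs ξ) hu (hseg z hz u hu) (hseg z' hz' u hu)
    -- The spherical average of `⟪a, u⟫²` turns `d²` into `d`; the final rate `√d` depends on this.
    _ = ENNReal.ofReal (2 * d * ‖a‖ ^ 2 + 8 * L ^ 2 * (d * β) ^ 2) := by
        rw [← ofReal_integral_eq_lintegral_ofReal hint
          (Filter.Eventually.of_forall fun u => by positivity),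
          integral_add ((integrable_inner_sq_unifSphere hd a).const_mul _) (integrable_const _),
          integral_const_mul, integral_inner_sq_unifSphere hd]
        simp only [integral_const, probReal_univ, one_smul]
        congr 2
        field_simp
    _ ≤ _ := by
        refine ENNReal.ofReal_le_ofReal ?_
        have h1 := (hs ξ).2 z (hXU hz) z' (hXU hz')
        have h2 : ‖a‖ ^ 2 ≤ (L * ‖z - z'‖) ^ 2 := by gcongr
        nlinarith


end Estimator

/-! ### The trajectory of the algorithm -/

theorem gradEstimate_value_of_dvd {d : ℕ} {Ξ : Type*} {p : Params} {F : E d → Ξ → ℝ} {t : ℕ}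
    (ht : t % p.q = 0) (s : State d) (batch : ℕ → Ξ × E d) :
    (gradEstimate p F t s batch).value =
      (1 / (p.b₁ : ℝ)) • ∑ i ∈ Finset.range p.b₁, estimator F p.β s.z (batch i) := by
  rw [gradEstimate, if_pos ht, Finset.sum_range]
  rfl

theorem gradEstimate_value_of_not_dvd {d : ℕ} {Ξ : Type*} {p : Params} {F : E d → Ξ → ℝ} {t : ℕ}
    (ht : t % p.q ≠ 0) (s : State d) (batch : ℕ → Ξ × E d) :
    (gradEstimate p F t s batch).value =
      (1 / (p.b₂ : ℝ)) • ∑ i ∈ Finset.range p.b₂,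
        (estimator F p.β s.z (batch i) - estimator F p.β s.zPrev (batch i)) + s.vPrev := by
  rw [gradEstimate, if_neg ht, Finset.sum_range]
  rfl

theorem measurable_gradEstimate {d : ℕ} {Ξ Ω : Type*} [MeasurableSpace Ξ]
    {mΩ : MeasurableSpace Ω} {p : Params} {F : E d → Ξ → ℝ}
    (hF : Measurable (Function.uncurry F)) (t : ℕ) {s : Ω → State d} {B : Ω → ℕ → Ξ × E d}
    (hB : ∀ i, Measurable fun ω => B ω i) (hz : Measurable fun ω => (s ω).z)
    (hz' : Measurable fun ω => (s ω).zPrev) (hv : Measurable fun ω => (s ω).vPrev) :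
    Measurable fun ω => (gradEstimate p F t (s ω) (B ω)).value := by
  have hest : ∀ {Z : Ω → E d}, Measurable Z → ∀ i,
      Measurable fun ω => estimator F p.β (Z ω) (B ω i) := fun hZ i =>
    measurable_estimator_comp hF p.β hZ (hB i)
  by_cases ht : t % p.q = 0
  · simp only [gradEstimate_value_of_dvd ht]
    have h : Measurable fun ω => ∑ i ∈ Finset.range p.b₁, estimator F p.β (s ω).z (B ω i) :=
      Finset.measurable_fun_sum _ fun i _ => hest hz i
    exact h.const_smul (1 / (p.b₁ : ℝ))
  · simp only [gradEstimate_value_of_not_dvd ht]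
    have h : Measurable fun ω => ∑ i ∈ Finset.range p.b₂,
        (estimator F p.β (s ω).z (B ω i) - estimator F p.β (s ω).zPrev (B ω i)) :=
      Finset.measurable_fun_sum _ fun i _ => (hest hz i).sub (hest hz' i)
    exact (h.const_smul (1 / (p.b₂ : ℝ))).add hv

theorem measurable_run {d : ℕ} {Ξ Ω : Type*} [MeasurableSpace Ξ] {mΩ : MeasurableSpace Ω}
    {p : Params} {F : E d → Ξ → ℝ} (hF : Measurable (Function.uncurry F))
    {lmo : ℕ → E d → E d} (hlmo : ∀ t, Measurable (lmo t)) (z₀ : E d)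
    {B : Ω → ℕ → ℕ → Ξ × E d} (t : ℕ) (hB : ∀ s < t, ∀ i, Measurable fun ω => B ω s i) :
    (Measurable fun ω => (run p F lmo z₀ (B ω) t).x) ∧
    (Measurable fun ω => (run p F lmo z₀ (B ω) t).y) ∧
    (Measurable fun ω => (run p F lmo z₀ (B ω) t).z) ∧
    (Measurable fun ω => (run p F lmo z₀ (B ω) t).zPrev) ∧
    (Measurable fun ω => (run p F lmo z₀ (B ω) t).vPrev) := by
  induction t with
  | zero => simp [run]
  | succ t ih =>
    obtain ⟨hx, hy, hz, hz', hv⟩ := ih fun s hs => hB s (hs.trans t.lt_succ_self)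
    have hg := measurable_gradEstimate (p := p) hF t (hB t t.lt_succ_self) hz hz' hv
    have hw := (hlmo t).comp hg
    have hx' := hx.add ((hw.sub hx).const_smul (p.γ t))
    have hy' := hz.add ((hw.sub hz).const_smul (p.η t))
    exact ⟨hx', hy', (hy'.const_smul (1 - p.α (t + 1))).add (hx'.const_smul (p.α (t + 1))), hz, hg⟩

/-- The step size `T^{-1/2}`. -/
noncomputable def stepSize (T : ℕ) : ℝ := (T : ℝ) ^ (-(1 / 2) : ℝ)

theorem stepSize_eq (T : ℕ) : stepSize T = (√(T : ℝ))⁻¹ := by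
  rw [stepSize, Real.rpow_neg T.cast_nonneg, Real.sqrt_eq_rpow]

theorem stepSize_pos {T : ℕ} (hT : 3 ≤ T) : 0 < stepSize T := by
  rw [stepSize_eq]; positivity

theorem stepSize_sq {T : ℕ} : stepSize T ^ 2 = (T : ℝ)⁻¹ := by
  rw [stepSize_eq, inv_pow, Real.sq_sqrt T.cast_nonneg]

/-- The value `2 / 3` is the reciprocal of `1 + θ_0 = 3 / 2`, which is what makes every `γ_t ≤ 1`.
-/
theorem stepSize_le {T : ℕ} (hT : 3 ≤ T) : stepSize T ≤ 2 / 3 := by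
  have h3 : (3 : ℝ) ≤ T := by exact_mod_cast hT
  refine le_of_sq_le_sq ?_ (by norm_num)
  rw [stepSize_sq]
  exact (inv_anti₀ (by norm_num) h3).trans (by norm_num)

section Trajectory

variable {d T q : ℕ} {Ξ : Type*} {F : E d → Ξ → ℝ} {lmo : ℕ → E d → E d} {z₀ : E d}
  {B : ℕ → ℕ → Ξ × E d} {X : Set (E d)}

local notation "𝓡" => run (params d T q) F lmo z₀ B

/-- The estimate `v_t` is stored as `vPrev` of the state at time `t + 1`, so `w_t` is `lmo t (𝓡 (t +
1)).vPrev`. -/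
theorem run_succ_x (t : ℕ) : (𝓡 (t + 1)).x = (𝓡 t).x +
    ((1 + 1 / (((t : ℝ) + 1) * ((t : ℝ) + 2))) * stepSize T) •
      (lmo t (𝓡 (t + 1)).vPrev - (𝓡 t).x) := rfl

theorem run_succ_y (t : ℕ) :
    (𝓡 (t + 1)).y = (𝓡 t).z + stepSize T • (lmo t (𝓡 (t + 1)).vPrev - (𝓡 t).z) := rfl

theorem run_z (t : ℕ) : (𝓡 t).z =
    (1 - 1 / ((t : ℝ) + 1)) • (𝓡 t).y + (1 / ((t : ℝ) + 1)) • (𝓡 t).x := by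
  cases t with
  | zero => simp [run]
  | succ t => rfl

theorem run_succ_zPrev (t : ℕ) : (𝓡 (t + 1)).zPrev = (𝓡 t).z := rfl

theorem momentum_factor_le_one {T : ℕ} (hT : 3 ≤ T) (t : ℕ) :
    (1 + 1 / (((t : ℝ) + 1) * ((t : ℝ) + 2))) * stepSize T ≤ 1 := by
  have h1 : 1 / (((t : ℝ) + 1) * ((t : ℝ) + 2)) ≤ 1 / 2 := by
    apply one_div_le_one_div_of_le (by norm_num)
    nlinarith [t.cast_nonneg (α := ℝ)]
  nlinarith [stepSize_le hT, stepSize_pos hT]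

theorem run_mem (hT : 3 ≤ T) (hX : Convex ℝ X) (hlmo : ∀ t, IsLMO X (lmo t)) (hz₀ : z₀ ∈ X)
    (t : ℕ) : (𝓡 t).x ∈ X ∧ (𝓡 t).y ∈ X ∧ (𝓡 t).z ∈ X := by
  have hz : ∀ t, (𝓡 t).x ∈ X → (𝓡 t).y ∈ X → (𝓡 t).z ∈ X := by
    intro t hx hy
    rw [run_z]
    refine hX hy hx ?_ (by positivity) (by ring)
    have : 1 / ((t : ℝ) + 1) ≤ 1 := by
      rw [div_le_one (by positivity)]; linarith [t.cast_nonneg (α := ℝ)]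
    linarith
  have hη := stepSize_pos hT
  induction t with
  | zero => exact ⟨hz₀, hz₀, hz₀⟩
  | succ t ih =>
    have hw := ((hlmo t).2 (𝓡 (t + 1)).vPrev).1
    have hx : (𝓡 (t + 1)).x ∈ X := by
      rw [run_succ_x]
      exact hX.add_smul_sub_mem ih.1 hw ⟨by positivity, momentum_factor_le_one hT t⟩
    have hy : (𝓡 (t + 1)).y ∈ X := by
      rw [run_succ_y]
      exact hX.add_smul_sub_mem ih.2.2 hw ⟨hη.le, (stepSize_le hT).trans (by norm_num)⟩
    exact ⟨hx, hy, hz _ hx hy⟩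

/-- The gap between the two sequences, measured in any direction. -/
theorem inner_run_x_sub_y_le (hT : 3 ≤ T) (hX : Convex ℝ X) (hlmo : ∀ t, IsLMO X (lmo t))
    (hz₀ : z₀ ∈ X) {g : E d} {K : ℝ} (hK : ∀ a ∈ X, ∀ b ∈ X, ⟪g, a - b⟫ ≤ K) (t : ℕ) :
    ⟪g, (𝓡 t).x - (𝓡 t).y⟫ ≤ stepSize T * K := by
  have hη := stepSize_pos hT
  have hη1 := stepSize_le hT
  have hK0 : 0 ≤ K := by simpa using hK z₀ hz₀ z₀ hz₀
  induction t with
  | zero => simpa [run] using mul_nonneg hη.le hK0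
  | succ t ih =>
    have hw := hK _ ((hlmo t).2 (𝓡 (t + 1)).vPrev).1 _ (run_mem hT hX hlmo hz₀ t
      (F := F) (q := q) (B := B)).1
    set α : ℝ := 1 / ((t : ℝ) + 1) with hα
    set θ : ℝ := 1 / (((t : ℝ) + 1) * ((t : ℝ) + 2)) with hθ
    have hα0 : 0 ≤ 1 - α := by
      have : α ≤ 1 := by
        rw [hα, div_le_one (by positivity)]; linarith [t.cast_nonneg (α := ℝ)]
      linarith
    have hθ0 : 0 ≤ θ := by positivity
    have hθα : θ ≤ α := by
      apply one_div_le_one_div_of_le (by positivity)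
      nlinarith [t.cast_nonneg (α := ℝ)]
    -- The difference contracts by at least `1 - α_t` and receives only `θ_t η (w_t - x_t)`; since
    -- `θ_t ≤ α_t`, the bound `η K` is preserved.
    have h1 : (𝓡 (t + 1)).x - (𝓡 (t + 1)).y = ((1 - stepSize T) * (1 - α)) • ((𝓡 t).x - (𝓡 t).y) +
        (θ * stepSize T) • (lmo t (𝓡 (t + 1)).vPrev - (𝓡 t).x) := by
      rw [run_succ_x, run_succ_y, run_z t]
      module
    rw [h1, inner_add_right, inner_smul_right, inner_smul_right]
    calc (1 - stepSize T) * (1 - α) * ⟪g, (𝓡 t).x - (𝓡 t).y⟫ +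
          θ * stepSize T * ⟪g, lmo t (𝓡 (t + 1)).vPrev - (𝓡 t).x⟫
        ≤ (1 - stepSize T) * (1 - α) * (stepSize T * K) + θ * stepSize T * K := by
          have : 0 ≤ 1 - stepSize T := by linarith
          gcongr
      _ = ((1 - stepSize T) * (1 - α) + θ) * (stepSize T * K) := by ring
      _ ≤ 1 * (stepSize T * K) := by
          have : 0 ≤ stepSize T * K := by positivity
          gcongr
          nlinarith
      _ = stepSize T * K := one_mul _

/-- The directional bound is used in the direction of `x_t - y_t` itself, and one factor of the norm
cancels. -/
theorem norm_run_x_sub_y_le (hT : 3 ≤ T) (hX : Convex ℝ X) (hlmo : ∀ t, IsLMO X (lmo t))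
    (hz₀ : z₀ ∈ X) {D : ℝ} (hD : 0 ≤ D) (hXD : ∀ x ∈ X, ∀ y ∈ X, ‖x - y‖ ≤ D) (t : ℕ) :
    ‖(𝓡 t).x - (𝓡 t).y‖ ≤ stepSize T * D := by
  have h := inner_run_x_sub_y_le hT hX hlmo hz₀ (g := (𝓡 t).x - (𝓡 t).y)
    (K := ‖(𝓡 t).x - (𝓡 t).y‖ * D) (F := F) (q := q) (B := B)
    (fun a ha b hb => (real_inner_le_norm _ _).trans (by gcongr; exact hXD a ha b hb)) t
  rw [real_inner_self_eq_norm_sq] at h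
  have hη := stepSize_pos hT
  by_contra! hlt
  have : 0 ≤ stepSize T * D := by positivity
  nlinarith

theorem run_succ_z_sub_y (t : ℕ) : (𝓡 (t + 1)).z - (𝓡 (t + 1)).y =
    (1 / ((t : ℝ) + 2)) • ((𝓡 (t + 1)).x - (𝓡 (t + 1)).y) := by
  rw [run_z]
  have : ((t + 1 : ℕ) : ℝ) + 1 = t + 2 := by push_cast; ring
  rw [this]
  module

theorem norm_run_z_succ_sub_y_le (hT : 3 ≤ T) (hX : Convex ℝ X) (hlmo : ∀ t, IsLMO X (lmo t))
    (hz₀ : z₀ ∈ X) {D : ℝ} (hD : 0 ≤ D) (hXD : ∀ x ∈ X, ∀ y ∈ X, ‖x - y‖ ≤ D) (t : ℕ) :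
    ‖(𝓡 (t + 1)).z - (𝓡 (t + 1)).y‖ ≤ stepSize T * D := by
  rw [run_succ_z_sub_y, norm_smul, Real.norm_of_nonneg (by positivity)]
  refine (mul_le_of_le_one_left (norm_nonneg _) ?_).trans
    (norm_run_x_sub_y_le hT hX hlmo hz₀ hD hXD _)
  rw [div_le_one (by positivity)]
  linarith [t.cast_nonneg (α := ℝ)]

theorem norm_run_y_succ_sub_z_le (hT : 3 ≤ T) (hX : Convex ℝ X) (hlmo : ∀ t, IsLMO X (lmo t))
    (hz₀ : z₀ ∈ X) {D : ℝ} (hXD : ∀ x ∈ X, ∀ y ∈ X, ‖x - y‖ ≤ D) (t : ℕ) :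
    ‖(𝓡 (t + 1)).y - (𝓡 t).z‖ ≤ stepSize T * D := by
  have hη := stepSize_pos hT
  rw [run_succ_y, add_sub_cancel_left, norm_smul, Real.norm_of_nonneg hη.le]
  gcongr
  exact hXD _ ((hlmo t).2 _).1 _ (run_mem hT hX hlmo hz₀ t).2.2

theorem norm_run_z_succ_sub_z_le (hT : 3 ≤ T) (hX : Convex ℝ X) (hlmo : ∀ t, IsLMO X (lmo t))
    (hz₀ : z₀ ∈ X) {D : ℝ} (hD : 0 ≤ D) (hXD : ∀ x ∈ X, ∀ y ∈ X, ‖x - y‖ ≤ D) (t : ℕ) :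
    ‖(𝓡 (t + 1)).z - (𝓡 t).z‖ ≤ 2 * (stepSize T * D) := by
  have h1 := norm_run_z_succ_sub_y_le hT hX hlmo hz₀ hD hXD t (F := F) (q := q) (B := B)
  have h2 := norm_run_y_succ_sub_z_le hT hX hlmo hz₀ hXD t (F := F) (q := q) (B := B)
  have h3 := norm_sub_le_norm_sub_add_norm_sub (𝓡 (t + 1)).z (𝓡 (t + 1)).y (𝓡 t).z
  linarith

/-! ### Descent along the trajectory. -/

variable {f : E d → ℝ} {U : Set (E d)} {L D Δ : ℝ}

/-- On the feasible directions the gradient is bounded in terms of the oscillation of `f`. -/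
theorem inner_gradient_le (hX : Convex ℝ X) (hL : 0 ≤ L) (hU : IsOpen U) (hXU : X ⊆ U)
    (hf : IsSmoothOn L f U) (hXD : ∀ x ∈ X, ∀ y ∈ X, ‖x - y‖ ≤ D)
    (hΔ : ∀ x ∈ X, ∀ y ∈ X, f x - f y ≤ Δ) {x a b : E d} (hx : x ∈ X) (ha : a ∈ X) (hb : b ∈ X) :
    ⟪gradient f x, a - b⟫ ≤ 2 * (Δ + L * D ^ 2) := by
  -- Linearizing at `x`, the slope towards `w` differs from `f w - f x` by at most `L D²`.
  have h : ∀ w ∈ X, |⟪gradient f x, w - x⟫| ≤ Δ + L * D ^ 2 := by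
    intro w hw
    have h1 := hf.abs_sub_sub_inner_le hL hU ((hX.segment_subset hx hw).trans hXU)
    have h2 : L * ‖w - x‖ ^ 2 ≤ L * D ^ 2 := by gcongr; exact hXD w hw x hx
    have h3 := hΔ w hw x hx
    have h4 := hΔ x hx w hw
    rw [abs_le] at h1 ⊢
    constructor <;> linarith
  have h1 := abs_le.1 (h a ha)
  have h2 := abs_le.1 (h b hb)
  have h3 : ⟪gradient f x, a - b⟫ = ⟪gradient f x, a - x⟫ - ⟪gradient f x, b - x⟫ := by
    rw [← inner_sub_right, sub_sub_sub_cancel_right]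
  linarith

/-- The decrease of `f` in one iteration. -/
theorem stepSize_mul_fwGap_le (hT : 3 ≤ T) (hX : Convex ℝ X) (hXc : IsCompact X)
    (hlmo : ∀ t, IsLMO X (lmo t)) (hz₀ : z₀ ∈ X) (hD : 0 ≤ D) (hL : 0 ≤ L) (hU : IsOpen U)
    (hXU : X ⊆ U) (hf : IsSmoothOn L f U) (hXD : ∀ x ∈ X, ∀ y ∈ X, ‖x - y‖ ≤ D)
    (hΔ : ∀ x ∈ X, ∀ y ∈ X, f x - f y ≤ Δ) (t : ℕ) :
    stepSize T * fwGap X f (𝓡 t).z ≤ f (𝓡 t).z - f (𝓡 (t + 1)).z +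
      stepSize T * D * ‖(𝓡 (t + 1)).vPrev - gradient f (𝓡 t).z‖ +
      2 * L * D ^ 2 * stepSize T ^ 2 +
      2 * (Δ + L * D ^ 2) * stepSize T * (1 / ((t : ℝ) + 2)) := by
  have hη := stepSize_pos hT
  have hz : (𝓡 t).z ∈ X := (run_mem hT hX hlmo hz₀ t).2.2
  have hz1 : (𝓡 (t + 1)).z ∈ X := (run_mem hT hX hlmo hz₀ (t + 1)).2.2
  have hy1 : (𝓡 (t + 1)).y ∈ X := (run_mem hT hX hlmo hz₀ (t + 1)).2.1
  have hzy := norm_run_z_succ_sub_y_le hT hX hlmo hz₀ hD hXD t (F := F) (q := q) (B := B)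
  have hyz := norm_run_y_succ_sub_z_le hT hX hlmo hz₀ hXD t (F := F) (q := q) (B := B)
  have hxy := inner_run_x_sub_y_le hT hX hlmo hz₀ (F := F) (q := q) (B := B)
    (fun a ha b hb => inner_gradient_le hX hL hU hXU hf hXD hΔ hy1 ha hb) (t + 1)
  have h1 := hf.abs_sub_sub_inner_le hL hU ((hX.segment_subset hy1 hz1).trans hXU)
  have h2 := hf.abs_sub_sub_inner_le hL hU ((hX.segment_subset hz hy1).trans hXU)
  rw [run_succ_z_sub_y, inner_smul_right, ← run_succ_z_sub_y] at h1
  have h3 : L * ‖(𝓡 (t + 1)).z - (𝓡 (t + 1)).y‖ ^ 2 ≤ L * (stepSize T * D) ^ 2 := by gcongr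
  have h4 : L * ‖(𝓡 (t + 1)).y - (𝓡 t).z‖ ^ 2 ≤ L * (stepSize T * D) ^ 2 := by gcongr
  have h5 : 1 / ((t : ℝ) + 2) * ⟪gradient f (𝓡 (t + 1)).y, (𝓡 (t + 1)).x - (𝓡 (t + 1)).y⟫ ≤
      1 / ((t : ℝ) + 2) * (stepSize T * (2 * (Δ + L * D ^ 2))) := by gcongr
  obtain ⟨w, hw, hgap⟩ := exists_inner_eq_fwGap hXc ⟨_, hz⟩ f (𝓡 t).z
  have h6 := ((hlmo t).2 (𝓡 (t + 1)).vPrev).2 w hw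
  -- The oracle point is compared with the maximizer `w` of the gap. It is at least as good as `w`
  -- for `v_t`, so for the true gradient it loses at most `⟪v_t - ∇f, w - w_t⟫`.
  have h7 : ⟪gradient f (𝓡 t).z, lmo t (𝓡 (t + 1)).vPrev - (𝓡 t).z⟫ ≤
      -fwGap X f (𝓡 t).z + D * ‖(𝓡 (t + 1)).vPrev - gradient f (𝓡 t).z‖ := by
    have h8 : ⟪(𝓡 (t + 1)).vPrev - gradient f (𝓡 t).z, w - lmo t (𝓡 (t + 1)).vPrev⟫ ≤
        ‖(𝓡 (t + 1)).vPrev - gradient f (𝓡 t).z‖ * D :=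
      (real_inner_le_norm _ _).trans (by
        gcongr; exact hXD _ hw _ ((hlmo t).2 _).1)
    rw [← hgap]
    simp only [inner_sub_left, inner_sub_right, inner_neg_right, real_inner_comm] at h6 h8 ⊢
    linarith
  have h9 : ⟪gradient f (𝓡 t).z, (𝓡 (t + 1)).y - (𝓡 t).z⟫ =
      stepSize T * ⟪gradient f (𝓡 t).z, lmo t (𝓡 (t + 1)).vPrev - (𝓡 t).z⟫ := by
    rw [run_succ_y, add_sub_cancel_left, inner_smul_right]
  rw [h9] at h2
  have h10 := mul_le_mul_of_nonneg_left h7 hη.le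
  rw [abs_le] at h1 h2
  linarith

/-- The sum has logarithmic size, but the factor `η = 1 / √T` in front of it absorbs `√T`. Each term
is at most `2 (√(T+1) - √T)`. -/
theorem sum_one_div_add_two_le (T : ℕ) :
    ∑ t ∈ Finset.range T, 1 / ((t : ℝ) + 2) ≤ 2 * √(T : ℝ) := by
  induction T with
  | zero => simp
  | succ T ih =>
    rw [Finset.sum_range_succ]
    have h0 : (0 : ℝ) ≤ T := T.cast_nonneg
    have h1 := Real.sq_sqrt h0
    have h2 := Real.sq_sqrt (by positivity : (0 : ℝ) ≤ (T + 1 : ℕ))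
    have h3 := Real.sqrt_nonneg (T : ℝ)
    have h4 : √(T : ℝ) ≤ √((T + 1 : ℕ) : ℝ) := Real.sqrt_le_sqrt (by push_cast; linarith)
    set a := √(T : ℝ)
    set b := √((T + 1 : ℕ) : ℝ)
    push_cast at h2
    have h5 : 1 / ((T : ℝ) + 2) ≤ 2 * (b - a) := by
      rw [div_le_iff₀ (by positivity)]
      have h6 : (b - a) * (b + a) = 1 := by nlinarith
      have h7 : b + a ≤ 2 * (T + 2) := by nlinarith [sq_nonneg (b - 1), sq_nonneg (a - 1)]
      nlinarith
    linarith

theorem average_fwGap_le (hT : 3 ≤ T) (hX : Convex ℝ X) (hXc : IsCompact X)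
    (hlmo : ∀ t, IsLMO X (lmo t)) (hz₀ : z₀ ∈ X) (hD : 0 ≤ D) (hL : 0 ≤ L) (hU : IsOpen U)
    (hXU : X ⊆ U) (hf : IsSmoothOn L f U) (hXD : ∀ x ∈ X, ∀ y ∈ X, ‖x - y‖ ≤ D)
    (hΔ : ∀ x ∈ X, ∀ y ∈ X, f x - f y ≤ Δ) :
    1 / (T : ℝ) * ∑ t ∈ Finset.range T, fwGap X f (𝓡 t).z ≤
      (5 * Δ + 6 * L * D ^ 2) * stepSize T +
      D * (1 / (T : ℝ) * ∑ t ∈ Finset.range T, ‖(𝓡 (t + 1)).vPrev - gradient f (𝓡 t).z‖) := by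
  have hη := stepSize_pos hT
  have hT0 : (0 : ℝ) < T := by positivity
  have hsum := Finset.sum_le_sum fun t (_ : t ∈ Finset.range T) =>
    stepSize_mul_fwGap_le hT hX hXc hlmo hz₀ hD hL hU hXU hf hXD hΔ t (F := F) (q := q) (B := B)
  simp only [Finset.sum_add_distrib, ← Finset.mul_sum, Finset.sum_range_sub', Finset.sum_const,
    Finset.card_range, nsmul_eq_mul] at hsum
  have hz0 : (𝓡 0).z ∈ X := hz₀
  have h1 := hΔ _ hz0 _ (run_mem hT hX hlmo hz₀ T (F := F) (q := q) (B := B)).2.2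
  have hΔ0 : 0 ≤ Δ := by simpa using hΔ z₀ hz₀ z₀ hz₀
  have hηT : stepSize T * √(T : ℝ) = 1 := by
    rw [stepSize_eq, inv_mul_cancel₀ (by positivity)]
  have hη2 : stepSize T ^ 2 * T = 1 := by rw [stepSize_sq, inv_mul_cancel₀ hT0.ne']
  have h2 : 2 * (Δ + L * D ^ 2) * stepSize T * ∑ t ∈ Finset.range T, 1 / ((t : ℝ) + 2) ≤
      2 * (Δ + L * D ^ 2) * stepSize T * (2 * √(T : ℝ)) := by
    gcongr
    exact sum_one_div_add_two_le T
  have h3 : 2 * (Δ + L * D ^ 2) * stepSize T * (2 * √(T : ℝ)) = 4 * (Δ + L * D ^ 2) := by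
    linear_combination 4 * (Δ + L * D ^ 2) * hηT
  have h4 : (T : ℝ) * (2 * L * D ^ 2 * stepSize T ^ 2) = 2 * L * D ^ 2 := by
    linear_combination 2 * L * D ^ 2 * hη2
  set G := ∑ t ∈ Finset.range T, fwGap X f (𝓡 t).z
  set W := ∑ t ∈ Finset.range T, ‖(𝓡 (t + 1)).vPrev - gradient f (𝓡 t).z‖
  -- Telescoping gives `Δ`, the curvature terms `2 L D²` and the momentum terms `4 (Δ + L D²)`.
  -- Another factor `η` produces the average, as `η² = 1 / T`.
  have h5 : stepSize T * G ≤ 5 * Δ + 6 * L * D ^ 2 + stepSize T * D * W := by linarith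
  have h6 := mul_le_mul_of_nonneg_left h5 hη.le
  have h7 : 1 / (T : ℝ) = stepSize T ^ 2 := by rw [stepSize_sq, one_div]
  rw [h7]
  linarith

end Trajectory


/-! ### The error of the gradient estimate -/

section Randomness

variable {d T q : ℕ} {Ξ Ω : Type*} [MeasurableSpace Ξ] {sample : ℕ → ℕ → Ω → Ξ × E d}
  {X : Set (E d)} {F : E d → Ξ → ℝ} {lmo : ℕ → E d → E d} {z₀ : E d}

local notation "𝓡" => fun ω : Ω => run (params d T q) F lmo z₀ (fun t i => sample t i ω)

/-- The information in the samples before the `j`-th sample of iteration `t`. -/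
abbrev pastSigma (sample : ℕ → ℕ → Ω → Ξ × E d) (t j : ℕ) : MeasurableSpace Ω :=
  ⨆ p ∈ {p : ℕ × ℕ | p.1 < t ∨ p.1 = t ∧ p.2 < j},
    MeasurableSpace.comap (sample p.1 p.2) inferInstance

theorem measurable_pastSigma {t j s i : ℕ} (h : s < t ∨ s = t ∧ i < j) :
    Measurable[pastSigma sample t j] (sample s i) :=
  measurable_iff_comap_le.2 (le_iSup₂_of_le (s, i) h le_rfl)

theorem measurable_run_pastSigma (hF : Measurable (Function.uncurry F))
    (hlmo : ∀ t, IsLMO X (lmo t)) (t j : ℕ) :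
    Measurable[pastSigma sample t j] fun ω => ((𝓡 ω t).z, (𝓡 ω t).zPrev, (𝓡 ω t).vPrev) := by
  have := AccSZOFW.measurable_run (mΩ := pastSigma sample t j) (p := params d T q) hF
    (fun t => (hlmo t).1) z₀ (B := fun ω t i => sample t i ω) t
    fun s hs i => measurable_pastSigma (Or.inl hs)
  exact this.2.2.1.prodMk (this.2.2.2.1.prodMk this.2.2.2.2)

variable [mΩ : MeasurableSpace Ω] {P : Measure Ξ} {μ : Measure Ω} {ζ : Ω → Fin T}

theorem IsRandomness.pastSigma_le (h : IsRandomness P μ sample ζ) (t j : ℕ) :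
    pastSigma sample t j ≤ mΩ :=
  iSup₂_le fun p _ => (h.measurable_sample p.1 p.2).comap_le

theorem IsRandomness.indep_pastSigma (h : IsRandomness P μ sample ζ) (t j : ℕ) :
    Indep (pastSigma sample t j) (MeasurableSpace.comap (sample t j) inferInstance) μ := by
  have := indep_iSup_of_disjoint (fun p : ℕ × ℕ => (h.measurable_sample p.1 p.2).comap_le)
    h.iIndep_sample (S := {p : ℕ × ℕ | p.1 < t ∨ p.1 = t ∧ p.2 < j}) (T := {(t, j)})
    (by simp)
  rwa [iSup_singleton] at this

theorem IsRandomness.measurable_run (h : IsRandomness P μ sample ζ)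
    (hF : Measurable (Function.uncurry F)) (hlmo : ∀ t, IsLMO X (lmo t)) (t : ℕ) :
    (Measurable fun ω => (𝓡 ω t).z) ∧ (Measurable fun ω => (𝓡 ω t).vPrev) := by
  have := AccSZOFW.measurable_run (p := params d T q) hF (fun t => (hlmo t).1) z₀
    (B := fun ω t i => sample t i ω) t fun s _ i => h.measurable_sample s i
  exact ⟨this.2.2.1, this.2.2.2.2⟩

variable {L D Δ σ : ℝ} [IsProbabilityMeasure P] [IsProbabilityMeasure μ]

/-- At a restart, given the past, the deviation is an average of `b₁` independent centred estimators
at the fixed point `z_t`. -/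
theorem lintegral_gradEstimate_of_dvd (hd : 1 ≤ d) (hT : 3 ≤ T)
    (h : Assumptions X F P (params d T q).β L D Δ σ) (hr : IsRandomness P μ sample ζ)
    (hlmo : ∀ t, IsLMO X (lmo t)) (hz₀ : z₀ ∈ X) {t : ℕ} (ht : t % q = 0) :
    ∫⁻ ω, ‖(𝓡 ω (t + 1)).vPrev - meanEstimator F P (params d T q).β (𝓡 ω t).z‖ₑ ^ 2 ∂μ ≤
      ENNReal.ofReal (σ ^ 2 / (params d T q).b₁) := by
  have := isProbabilityMeasure_unifSphere hd
  set β := (params d T q).β with hβ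
  have hb : (params d T q).b₁ ≠ 0 := by
    have : 0 < ⌈(T : ℝ) / (d : ℝ)⌉₊ := Nat.ceil_pos.2 (by positivity)
    exact this.ne'
  have hmean := measurable_meanEstimator (P := P) hd h.measurable β
  have key := lintegral_enorm_add_average_sq_le (pastSigma sample t) (hr.pastSigma_le t)
    (measurable_run_pastSigma (T := T) (q := q) (z₀ := z₀) h.measurable hlmo t)
    (fun i j hij => measurable_pastSigma (Or.inr ⟨rfl, hij⟩)) (hr.measurable_sample t)
    (hr.indep_pastSigma t) (hr.law_sample t) (e := fun _ => (0 : E d)) measurable_const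
    (h := fun a s => estimator F β a.1 s - meanEstimator F P β a.1)
    ((measurable_estimator_comp h.measurable β (measurable_fst.comp measurable_fst)
      measurable_snd).sub (hmean.comp (measurable_fst.comp measurable_fst)))
    (G := {a | a.1 ∈ X}) (measurable_fst h.compact.measurableSet)
    (fun ω => (run_mem hT h.convex hlmo hz₀ t).2.2) (K := σ ^ 2)
    (fun a ha => (h.memLp_estimator hd ha).sub (memLp_const _))
    (fun a ha => by
      rw [integral_sub ((h.memLp_estimator hd ha).integrable one_le_two) (integrable_const _),
        integral_const, probReal_univ, one_smul]
      exact sub_self _)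
    (fun a ha => h.lintegral_estimator_sub_mean_le hd ha) hb
  simp only [zero_add, enorm_zero, ne_eq, OfNat.ofNat_ne_zero, not_false_eq_true, zero_pow,
    lintegral_zero] at key
  refine le_trans (le_of_eq (lintegral_congr fun ω => ?_)) key
  have hv : (𝓡 ω (t + 1)).vPrev = (1 / ((params d T q).b₁ : ℝ)) •
      ∑ i ∈ Finset.range (params d T q).b₁, estimator F β (𝓡 ω t).z (sample t i ω) :=
    gradEstimate_value_of_dvd (p := params d T q) ht _ _
  have hb' : ((params d T q).b₁ : ℝ) ≠ 0 := by exact_mod_cast hb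
  rw [hv, Finset.sum_sub_distrib, Finset.sum_const, Finset.card_range, smul_sub,
    ← Nat.cast_smul_eq_nsmul ℝ, smul_smul, one_div_mul_cancel hb', one_smul]

/-- The martingale step: the new deviation is the old one plus an average of corrections centred
given the past, so second moments add. -/
theorem lintegral_gradEstimate_succ_of_not_dvd (hd : 1 ≤ d) (hT : 3 ≤ T) (hq : 1 ≤ q)
    (hL : 0 ≤ L) (hD : 0 ≤ D) (h : Assumptions X F P (params d T q).β L D Δ σ)
    (hr : IsRandomness P μ sample ζ) (hlmo : ∀ t, IsLMO X (lmo t)) (hz₀ : z₀ ∈ X) {t : ℕ}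
    (ht : (t + 1) % q ≠ 0) :
    ∫⁻ ω, ‖(𝓡 ω (t + 2)).vPrev - meanEstimator F P (params d T q).β (𝓡 ω (t + 1)).z‖ₑ ^ 2 ∂μ ≤
      ∫⁻ ω, ‖(𝓡 ω (t + 1)).vPrev - meanEstimator F P (params d T q).β (𝓡 ω t).z‖ₑ ^ 2 ∂μ +
      ENNReal.ofReal ((2 * d * L ^ 2 * (2 * (stepSize T * D)) ^ 2 +
        8 * L ^ 2 * stepSize T ^ 2) / q) := by
  have := isProbabilityMeasure_unifSphere hd
  have hd' : (0 : ℝ) < d := by positivity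
  set β := (params d T q).β with hβ
  have hη := stepSize_pos hT
  have hβη : d * β = stepSize T := mul_inv_cancel_left₀ hd'.ne' (stepSize T)
  have hβ0 : 0 < β := by
    have : β = (d : ℝ)⁻¹ * stepSize T := rfl
    rw [this]; positivity
  have hmean := measurable_meanEstimator (P := P) hd h.measurable β
  let h' : E d × E d × E d → Ξ × E d → E d := fun a s =>
    estimator F β a.1 s - estimator F β a.2.1 s -
      (meanEstimator F P β a.1 - meanEstimator F P β a.2.1)
  have hh' : Measurable (Function.uncurry h') := by
    have h1 : Measurable fun p : (E d × E d × E d) × (Ξ × E d) => p.1.1 := by fun_prop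
    have h2 : Measurable fun p : (E d × E d × E d) × (Ξ × E d) => p.1.2.1 := by fun_prop
    exact ((measurable_estimator_comp h.measurable β h1 measurable_snd).sub
      (measurable_estimator_comp h.measurable β h2 measurable_snd)).sub
      ((hmean.comp h1).sub (hmean.comp h2))
  -- The bound on `‖z_{t+1} - z_t‖` holds for every sample, so it can be built into the set of
  -- admissible pasts.
  let G : Set (E d × E d × E d) :=
    {a | a.1 ∈ X ∧ a.2.1 ∈ X ∧ ‖a.1 - a.2.1‖ ≤ 2 * (stepSize T * D)}
  have hG : MeasurableSet G := by
    have hX := h.compact.measurableSet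
    refine (measurable_fst hX).inter (((measurable_fst.comp measurable_snd) hX).inter ?_)
    have hm : Measurable fun a : E d × E d × E d => ‖a.1 - a.2.1‖ := by fun_prop
    exact measurableSet_le hm measurable_const
  have hL2 : ∀ a ∈ G, MemLp (fun s => estimator F β a.1 s - estimator F β a.2.1 s) 2
      (P.prod (unifSphere d)) := fun a ha =>
    (h.memLp_estimator hd ha.1).sub (h.memLp_estimator hd ha.2.1)
  have hint : ∀ a ∈ G, ∫ s, (estimator F β a.1 s - estimator F β a.2.1 s)
      ∂P.prod (unifSphere d) = meanEstimator F P β a.1 - meanEstimator F P β a.2.1 :=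
    fun a ha => integral_sub ((h.memLp_estimator hd ha.1).integrable one_le_two)
      ((h.memLp_estimator hd ha.2.1).integrable one_le_two)
  have key := lintegral_enorm_add_average_sq_le (pastSigma sample (t + 1))
    (hr.pastSigma_le (t + 1))
    (measurable_run_pastSigma (T := T) (q := q) (z₀ := z₀) h.measurable hlmo (t + 1))
    (fun i j hij => measurable_pastSigma (Or.inr ⟨rfl, hij⟩)) (hr.measurable_sample (t + 1))
    (hr.indep_pastSigma (t + 1)) (hr.law_sample (t + 1))
    (e := fun a => a.2.2 - meanEstimator F P β a.2.1)
    ((by fun_prop : Measurable fun a : E d × E d × E d => a.2.2).sub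
      (hmean.comp (by fun_prop : Measurable fun a : E d × E d × E d => a.2.1)))
    (h := h') hh' hG
    (fun ω => ⟨(run_mem hT h.convex hlmo hz₀ (t + 1)).2.2, (run_mem hT h.convex hlmo hz₀ t).2.2,
      norm_run_z_succ_sub_z_le hT h.convex hlmo hz₀ hD h.diam_le t⟩)
    (K := 2 * d * L ^ 2 * (2 * (stepSize T * D)) ^ 2 + 8 * L ^ 2 * stepSize T ^ 2)
    (fun a ha => (hL2 a ha).sub (memLp_const _))
    (fun a ha => by
      simp only [h']
      rw [integral_sub ((hL2 a ha).integrable one_le_two) (integrable_const _), hint a ha,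
        integral_const, probReal_univ, one_smul, sub_self])
    (fun a ha => by
      -- Comparison with the constant `0`: centring the correction only lowers its second moment.
      have h1 := lintegral_enorm_sub_integral_sq_le (hL2 a ha) 0
      simp only [hint a ha, sub_zero] at h1
      refine h1.trans ((h.lintegral_estimator_sub_le hd hL hβ0 ha.1 ha.2.1).trans ?_)
      rw [hβη]
      refine ENNReal.ofReal_le_ofReal ?_
      have := ha.2.2
      gcongr) (b := q) (by omega)
  refine le_trans (le_of_eq (lintegral_congr fun ω => ?_)) key
  have hv : (𝓡 ω (t + 2)).vPrev = (1 / (q : ℝ)) • ∑ i ∈ Finset.range q,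
      (estimator F β (𝓡 ω (t + 1)).z (sample (t + 1) i ω) -
        estimator F β (𝓡 ω t).z (sample (t + 1) i ω)) + (𝓡 ω (t + 1)).vPrev :=
    gradEstimate_value_of_not_dvd (p := params d T q) ht _ _
  have hq' : (q : ℝ) ≠ 0 := by positivity
  rw [hv]
  simp only [h', run_succ_zPrev]
  rw [Finset.sum_sub_distrib (g := fun _ => _ - _), Finset.sum_const, Finset.card_range, smul_sub,
    ← Nat.cast_smul_eq_nsmul ℝ, smul_smul, one_div_mul_cancel hq', one_smul]
  congr 2
  abel

end Randomness


/-! ### Expectations -/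

/-- The expectation of a process evaluated at an independent random index. -/
theorem integral_eval_index {Ω : Type*} [MeasurableSpace Ω] {μ : Measure Ω}
    {T : ℕ} {ζ : Ω → Fin T} (hζ : Measurable ζ) {Φ : ℕ → Ω → ℝ}
    (hind : ∀ k : Fin T, IndepFun ζ (Φ k) μ) (hΦ : ∀ t < T, Integrable (Φ t) μ) :
    Integrable (fun ω => Φ (ζ ω) ω) μ ∧
      ∫ ω, Φ (ζ ω) ω ∂μ = ∑ k : Fin T, μ.real (ζ ⁻¹' {k}) * ∫ ω, Φ k ω ∂μ := by
  have hpre : ∀ k : Fin T, MeasurableSet (ζ ⁻¹' {k}) := fun k => hζ (measurableSet_singleton k)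
  have heq : (fun ω => Φ (ζ ω) ω) = fun ω => ∑ k : Fin T, (ζ ⁻¹' {k}).indicator (Φ k) ω := by
    ext1 ω
    rw [Finset.sum_eq_single (ζ ω)]
    · simp
    · intro k _ hk
      exact Set.indicator_of_notMem (by simpa using hk.symm) _
    · simp
  have hint : ∀ k : Fin T, Integrable ((ζ ⁻¹' {k}).indicator (Φ k)) μ := fun k =>
    (hΦ k k.2).indicator (hpre k)
  rw [heq]
  refine ⟨integrable_finsetSum _ fun k _ => hint k, ?_⟩
  rw [integral_finsetSum _ fun k _ => hint k]
  refine Finset.sum_congr rfl fun k _ => ?_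
  have hφ : Measurable ((({k} : Set (Fin T)).indicator 1 : Fin T → ℝ)) :=
    measurable_one.indicator (measurableSet_singleton k)
  have h1 := ((hind k).comp hφ measurable_id).integral_mul_eq_mul_integral
    (hφ.comp hζ).aestronglyMeasurable (hΦ k k.2).aestronglyMeasurable
  have h2 : (({k} : Set (Fin T)).indicator 1 : Fin T → ℝ) ∘ ζ = (ζ ⁻¹' {k}).indicator 1 := by
    rfl
  have h3 : ((({k} : Set (Fin T)).indicator 1 : Fin T → ℝ) ∘ ζ) * (id ∘ Φ k) =
      (ζ ⁻¹' {k}).indicator (Φ k) := by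
    rw [h2]; ext ω; simp [Set.indicator]
  rw [h3, h2, integral_indicator_one (hpre k)] at h1
  exact h1

theorem measurable_comp_of_continuousOn {Ω V W : Type*} [MeasurableSpace Ω] [TopologicalSpace V]
    [MeasurableSpace V] [BorelSpace V] [TopologicalSpace W] [MeasurableSpace W] [BorelSpace W]
    {X : Set V} {g : V → W} (hg : ContinuousOn g X) {Z : Ω → V} (hZ : Measurable Z)
    (hZX : ∀ ω, Z ω ∈ X) : Measurable fun ω => g (Z ω) :=
  (continuousOn_iff_continuous_domRestrict.1 hg).measurable.comp (hZ.subtype_mk (h := hZX))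

theorem integrable_comp_of_continuousOn {Ω V : Type*} [MeasurableSpace Ω] {μ : Measure Ω}
    [IsFiniteMeasure μ] [TopologicalSpace V] [MeasurableSpace V] [BorelSpace V] {X : Set V}
    (hX : IsCompact X) {g : V → ℝ} (hg : ContinuousOn g X) {Z : Ω → V} (hZ : Measurable Z)
    (hZX : ∀ ω, Z ω ∈ X) : Integrable (fun ω => g (Z ω)) μ := by
  obtain ⟨C, hC⟩ := hX.exists_bound_of_continuousOn hg
  exact Integrable.of_bound (measurable_comp_of_continuousOn hg hZ hZX).aestronglyMeasurable C
    (Filter.Eventually.of_forall fun ω => hC _ (hZX ω))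

section Randomness

variable {d T q : ℕ} {Ξ Ω : Type*} [MeasurableSpace Ξ] {sample : ℕ → ℕ → Ω → Ξ × E d}
  {X : Set (E d)} {F : E d → Ξ → ℝ} {lmo : ℕ → E d → E d} {z₀ : E d}
  [MeasurableSpace Ω] {P : Measure Ξ} {μ : Measure Ω} {ζ : Ω → Fin T}
  {L D Δ σ : ℝ} [IsProbabilityMeasure P] [IsProbabilityMeasure μ]

local notation "𝓡" => fun ω : Ω => run (params d T q) F lmo z₀ (fun t i => sample t i ω)

/-- The factor `t % q` counts the corrections made since the last restart. -/
theorem lintegral_gradEstimate_le (hd : 1 ≤ d) (hT : 3 ≤ T) (hq : 1 ≤ q)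
    (hL : 0 ≤ L) (hD : 0 ≤ D) (h : Assumptions X F P (params d T q).β L D Δ σ)
    (hr : IsRandomness P μ sample ζ) (hlmo : ∀ t, IsLMO X (lmo t)) (hz₀ : z₀ ∈ X) (t : ℕ) :
    ∫⁻ ω, ‖(𝓡 ω (t + 1)).vPrev - meanEstimator F P (params d T q).β (𝓡 ω t).z‖ₑ ^ 2 ∂μ ≤
      ENNReal.ofReal (σ ^ 2 / (params d T q).b₁ + (t % q : ℕ) *
        ((2 * d * L ^ 2 * (2 * (stepSize T * D)) ^ 2 + 8 * L ^ 2 * stepSize T ^ 2) / q)) := by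
  set κ := 2 * d * L ^ 2 * (2 * (stepSize T * D)) ^ 2 + 8 * L ^ 2 * stepSize T ^ 2 with hκ
  have hκ0 : 0 ≤ κ := by positivity
  induction t with
  | zero => simpa using lintegral_gradEstimate_of_dvd hd hT h hr hlmo hz₀ (Nat.zero_mod q)
  | succ t ih =>
    by_cases ht : (t + 1) % q = 0
    · simpa [ht] using lintegral_gradEstimate_of_dvd hd hT h hr hlmo hz₀ ht
    · refine (lintegral_gradEstimate_succ_of_not_dvd hd hT hq hL hD h hr hlmo hz₀ ht).trans ?_
      refine (add_le_add_left ih _).trans (le_of_eq ?_)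
      rw [← ENNReal.ofReal_add (by positivity) (by positivity)]
      have hmod : (t + 1) % q = t % q + 1 := by
        have hlt := Nat.mod_lt t hq
        rw [Nat.add_mod] at ht ⊢
        rcases Nat.lt_or_ge 1 q with h1 | h1
        · rw [Nat.mod_eq_of_lt h1] at ht ⊢
          refine Nat.mod_eq_of_lt (lt_of_le_of_ne hlt fun he => ht ?_)
          rw [show t % q + 1 = q from he, Nat.mod_self]
        · exact absurd (by rw [show q = 1 by omega]; exact Nat.mod_one _) ht
      rw [hmod]
      push_cast
      congr 1
      ring

/-- The choice `b₁ ≥ T / d` makes the restart error `σ² d η²`, and `b₂ = q` keeps the accumulated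
corrections of the same order. The bias accounts for one of the four `L`. -/
theorem integral_norm_gradEstimate_sub_gradient_le (hd : 1 ≤ d) (hT : 3 ≤ T) (hq : 1 ≤ q)
    (hL : 0 ≤ L) (hD : 0 ≤ D) (hσ : 0 ≤ σ) (h : Assumptions X F P (params d T q).β L D Δ σ)
    (hr : IsRandomness P μ sample ζ) (hlmo : ∀ t, IsLMO X (lmo t)) (hz₀ : z₀ ∈ X) (t : ℕ) :
    Integrable (fun ω => ‖(𝓡 ω (t + 1)).vPrev - gradient (objective F P) (𝓡 ω t).z‖) μ ∧
    ∫ ω, ‖(𝓡 ω (t + 1)).vPrev - gradient (objective F P) (𝓡 ω t).z‖ ∂μ ≤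
      (σ + 3 * L * D + 4 * L) * (√(d : ℝ) * stepSize T) := by
  have hd1 : (1 : ℝ) ≤ d := by exact_mod_cast hd
  have hd' : (0 : ℝ) < d := by positivity
  have hη := stepSize_pos hT
  have hβη : d * (params d T q).β = stepSize T := mul_inv_cancel_left₀ hd'.ne' (stepSize T)
  have hβ0 : 0 < (params d T q).β := pos_of_mul_pos_right (hβη ▸ hη) hd'.le
  set β := (params d T q).β with hβ
  set f := objective F P
  have hs1 : 1 ≤ √(d : ℝ) := Real.one_le_sqrt.2 hd1
  have hzX : ∀ ω, (𝓡 ω t).z ∈ X := fun ω => (run_mem hT h.convex hlmo hz₀ t).2.2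
  have hzm := (hr.measurable_run (q := q) (z₀ := z₀) h.measurable hlmo t).1
  have hvm := (hr.measurable_run (q := q) (z₀ := z₀) h.measurable hlmo (t + 1)).2
  have hV := lintegral_gradEstimate_le hd hT hq hL hD h hr hlmo hz₀ t
  obtain ⟨hi, hle⟩ := integral_norm_le_sqrt_of_lintegral_le
    (hvm.sub ((measurable_meanEstimator (P := P) hd h.measurable β).comp hzm)) hV
  have hpt : ∀ ω, ‖(𝓡 ω (t + 1)).vPrev - gradient f (𝓡 ω t).z‖ ≤
      ‖(𝓡 ω (t + 1)).vPrev - meanEstimator F P β (𝓡 ω t).z‖ + L * stepSize T := by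
    intro ω
    have h1 := h.norm_meanEstimator_sub_gradient_le hd hL hβ0 (hzX ω)
    rw [hβη] at h1
    exact (norm_sub_le_norm_sub_add_norm_sub _ _ _).trans (add_le_add_right h1 _)
  obtain ⟨U, hU, hXU, -, -, -, hf⟩ := h.exists_isSmoothOn hL hβ0.le
  have hgm : Measurable fun ω => gradient f (𝓡 ω t).z :=
    measurable_comp_of_continuousOn ((continuousOn_gradient_of_isSmoothOn hL hf).mono hXU) hzm hzX
  have hb := hi.norm.add (integrable_const (L * stepSize T))
  have hint : Integrable (fun ω => ‖(𝓡 ω (t + 1)).vPrev - gradient f (𝓡 ω t).z‖) μ :=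
    hb.mono' (hvm.sub hgm).norm.aestronglyMeasurable
      (Filter.Eventually.of_forall fun ω => (norm_norm _).trans_le (hpt ω))
  refine ⟨hint, (integral_mono hint hb hpt).trans ?_⟩
  rw [integral_add' hi.norm (integrable_const _), integral_const, probReal_univ, one_smul]
  have hb1 : σ ^ 2 / (params d T q).b₁ ≤ σ ^ 2 * (d * stepSize T ^ 2) := by
    have h1 : (T : ℝ) / d ≤ (params d T q).b₁ := Nat.le_ceil _
    have h2 : (0 : ℝ) < T / d := by positivity
    rw [stepSize_sq, div_eq_mul_inv]
    refine mul_le_mul_of_nonneg_left ((inv_anti₀ h2 h1).trans (le_of_eq ?_)) (sq_nonneg σ)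
    rw [inv_div, div_eq_mul_inv]
  have hmod : ((t % q : ℕ) : ℝ) *
      ((2 * d * L ^ 2 * (2 * (stepSize T * D)) ^ 2 + 8 * L ^ 2 * stepSize T ^ 2) / q) ≤
      2 * d * L ^ 2 * (2 * (stepSize T * D)) ^ 2 + 8 * L ^ 2 * stepSize T ^ 2 := by
    have h1 : ((t % q : ℕ) : ℝ) ≤ q := by exact_mod_cast (Nat.mod_lt t hq).le
    rw [mul_div_assoc', div_le_iff₀ (by positivity), mul_comm]
    gcongr
  have hsq : √(σ ^ 2 / (params d T q).b₁ + ((t % q : ℕ) : ℝ) *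
      ((2 * d * L ^ 2 * (2 * (stepSize T * D)) ^ 2 + 8 * L ^ 2 * stepSize T ^ 2) / q)) ≤
      (σ + 3 * L * D + 3 * L) * (√(d : ℝ) * stepSize T) := by
    refine Real.sqrt_le_iff.2 ⟨by positivity, (add_le_add hb1 hmod).trans ?_⟩
    have h1 : L ^ 2 * stepSize T ^ 2 ≤ d * (L ^ 2 * stepSize T ^ 2) :=
      le_mul_of_one_le_left (by positivity) hd1
    -- The `3`s are `√8` rounded up.
    have h2 : σ ^ 2 + 8 * L ^ 2 * D ^ 2 + 8 * L ^ 2 ≤ (σ + 3 * L * D + 3 * L) ^ 2 := by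
      have h3 : 0 ≤ L * D := by positivity
      have h4 : 0 ≤ σ * (L * D) := by positivity
      have h5 : 0 ≤ σ * L := by positivity
      have h6 : 0 ≤ L * D * L := by positivity
      nlinarith [sq_nonneg (L * D), sq_nonneg L]
    rw [mul_pow (σ + 3 * L * D + 3 * L), mul_pow (√(d : ℝ)), Real.sq_sqrt hd'.le]
    calc _ ≤ (σ ^ 2 + 8 * L ^ 2 * D ^ 2 + 8 * L ^ 2) * (d * stepSize T ^ 2) := by linarith
      _ ≤ _ := by gcongr
  have h3 : L * stepSize T ≤ L * (√(d : ℝ) * stepSize T) := by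
    gcongr
    exact le_mul_of_one_le_left hη.le hs1
  have h4 := hle.trans hsq
  simp only [Pi.sub_apply] at h4
  linarith

theorem integral_fwGap_le (hd : 1 ≤ d) (hT : 3 ≤ T) (hq : 1 ≤ q)
    (hL : 0 ≤ L) (hD : 0 ≤ D) (hσ : 0 ≤ σ) (hΔ : 0 ≤ Δ)
    (h : Assumptions X F P (params d T q).β L D Δ σ) (hr : IsRandomness P μ sample ζ)
    (hlmo : ∀ t, IsLMO X (lmo t)) (hz₀ : z₀ ∈ X) :
    (∀ t, Integrable (fun ω => fwGap X (objective F P) (𝓡 ω t).z) μ) ∧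
    1 / (T : ℝ) * ∑ t ∈ Finset.range T, ∫ ω, fwGap X (objective F P) (𝓡 ω t).z ∂μ ≤
      (5 * Δ + 6 * L * D ^ 2 + D * (σ + 3 * L * D + 4 * L)) * (√(d : ℝ) * stepSize T) := by
  have hd1 : (1 : ℝ) ≤ d := by exact_mod_cast hd
  have hη := stepSize_pos hT
  have hβ0 : 0 ≤ (params d T q).β :=
    mul_nonneg (inv_nonneg.2 d.cast_nonneg) hη.le
  obtain ⟨U, hU, hXU, -, -, -, hf⟩ := h.exists_isSmoothOn hL hβ0
  have hint : ∀ t, Integrable (fun ω => fwGap X (objective F P) (𝓡 ω t).z) μ := fun t =>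
    integrable_comp_of_continuousOn h.compact (continuousOn_iff_continuous_domRestrict.2
      (continuous_fwGap_restrict h.compact
        ((continuousOn_gradient_of_isSmoothOn hL hf).mono hXU)))
      (hr.measurable_run (q := q) (z₀ := z₀) h.measurable hlmo t).1
      fun ω => (run_mem hT h.convex hlmo hz₀ t).2.2
  have herr := integral_norm_gradEstimate_sub_gradient_le hd hT hq hL hD hσ h hr hlmo hz₀
  have hosc : ∀ x ∈ X, ∀ y ∈ X, objective F P x - objective F P y ≤ Δ := fun x hx y hy => by
    have h1 := h.gap_le x hx
    have h2 := csInf_le h.bddBelow (Set.mem_image_of_mem (objective F P) hy)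
    linarith
  refine ⟨hint, ?_⟩
  have hpt := fun ω => average_fwGap_le hT h.convex h.compact hlmo hz₀ hD hL hU hXU hf h.diam_le
    hosc (F := F) (q := q) (B := fun t i => sample t i ω)
  have hi1 : Integrable (fun ω => 1 / (T : ℝ) *
      ∑ t ∈ Finset.range T, fwGap X (objective F P) (𝓡 ω t).z) μ :=
    (integrable_finsetSum _ fun t _ => hint t).const_mul _
  have hi3 : Integrable (fun ω => ∑ t ∈ Finset.range T,
      ‖(𝓡 ω (t + 1)).vPrev - gradient (objective F P) (𝓡 ω t).z‖) μ :=
    integrable_finsetSum _ fun t _ => (herr t).1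
  have hi2 := (integrable_const (μ := μ) ((5 * Δ + 6 * L * D ^ 2) * stepSize T)).add
    ((hi3.const_mul (1 / (T : ℝ))).const_mul D)
  have hmono := integral_mono hi1 hi2 hpt
  rw [integral_const_mul, integral_finsetSum _ fun t _ => hint t,
    integral_add' (integrable_const _) ((hi3.const_mul (1 / (T : ℝ))).const_mul D),
    integral_const, probReal_univ, one_smul, integral_const_mul, integral_const_mul,
    integral_finsetSum _ fun t _ => (herr t).1] at hmono
  refine hmono.trans ?_
  have hT0 : (0 : ℝ) < T := by positivity
  have hsum := Finset.sum_le_sum fun t (_ : t ∈ Finset.range T) => (herr t).2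
  rw [Finset.sum_const, Finset.card_range, nsmul_eq_mul] at hsum
  have havg := mul_le_mul_of_nonneg_left hsum (by positivity : 0 ≤ 1 / (T : ℝ))
  rw [← mul_assoc, one_div_mul_cancel hT0.ne', one_mul] at havg
  have h1 : (5 * Δ + 6 * L * D ^ 2) * stepSize T ≤
      (5 * Δ + 6 * L * D ^ 2) * (√(d : ℝ) * stepSize T) := by
    gcongr
    exact le_mul_of_one_le_left hη.le (Real.one_le_sqrt.2 hd1)
  have h2 := mul_le_mul_of_nonneg_left havg hD
  linarith

end Randomness

/-! ### The number of queries -/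

theorem gradEstimate_queries {d : ℕ} {Ξ : Type*} (p : Params) (F : E d → Ξ → ℝ) (t : ℕ)
    (s : State d) (batch : ℕ → Ξ × E d) :
    (gradEstimate p F t s batch).queries = if t % p.q = 0 then p.b₁ * 2 else p.b₂ * 4 := by
  unfold gradEstimate
  split_ifs <;>
    simp [Counted.average, Counted.bind, Counted.pure, uniGE, oracle]

/-- The quotient is `⌈t / q⌉`, the number of restarts before time `t`; for simplicity every
iteration is also charged for a correction. -/
theorem run_queries_le {d : ℕ} {Ξ : Type*} {p : Params} (hq : 1 ≤ p.q) (F : E d → Ξ → ℝ)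
    (lmo : ℕ → E d → E d) (z₀ : E d) (B : ℕ → ℕ → Ξ × E d) (t : ℕ) :
    (run p F lmo z₀ B t).queries ≤ 2 * p.b₁ * ((t + p.q - 1) / p.q) + 4 * p.b₂ * t := by
  induction t with
  | zero => simp [run]
  | succ t ih =>
    have hstep : (run p F lmo z₀ B (t + 1)).queries = (run p F lmo z₀ B t).queries +
        (if t % p.q = 0 then p.b₁ * 2 else p.b₂ * 4) := by
      rw [← gradEstimate_queries p F t (run p F lmo z₀ B t) (B t)]
      rfl
    rw [hstep, Nat.add_right_comm, Nat.add_sub_cancel]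
    split_ifs with ht
    · obtain ⟨k, rfl⟩ := Nat.dvd_of_mod_eq_zero ht
      have h1 : (p.q * k + p.q) / p.q = k + 1 := by
        rw [Nat.add_div_right _ hq, Nat.mul_div_cancel_left _ hq]
      have h2 : (p.q * k + p.q - 1) / p.q = k := by
        rw [Nat.add_sub_assoc hq, Nat.mul_add_div hq, Nat.div_eq_of_lt (by omega), add_zero]
      rw [h2] at ih
      rw [h1]
      linarith [Nat.zero_le p.b₂]
    · have h1 : (t + p.q - 1) / p.q ≤ (t + p.q) / p.q := Nat.div_le_div_right (by omega)
      have h2 := Nat.mul_le_mul_left (2 * p.b₁) h1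
      linarith

theorem run_queries_le_of_accuracy {d T q : ℕ} {Ξ : Type*} (hd : 1 ≤ d) {M ε : ℝ} (hM : 0 ≤ M)
    (hε : 0 < ε) (hε1 : ε ≤ 1) (hT : T = ⌈M * d / ε ^ 2⌉₊) (hq : q = ⌈1 / ε⌉₊)
    (F : E d → Ξ → ℝ) (lmo : ℕ → E d → E d) (z₀ : E d) (B : ℕ → ℕ → Ξ × E d) :
    ((run (params d T q) F lmo z₀ B T).queries : ℝ) ≤
      (2 * (M + 2) ^ 2 + 8 * (M + 1)) * d / ε ^ 3 := by
  have hd1 : (1 : ℝ) ≤ d := by exact_mod_cast hd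
  have hd0 : (0 : ℝ) < d := by linarith
  -- In terms of `a`: `T = O(d a²)`, `b₁ = O(a²)`, `q = O(a)`, and there are `O(d a)` restarts, so
  -- both products are `O(d a³)`.
  obtain ⟨a, ha⟩ : ∃ a, a = 1 / ε := ⟨_, rfl⟩
  have ha1 : 1 ≤ a := by rw [ha, le_div_iff₀ hε]; linarith
  have hqa : a ≤ q := by rw [hq, ha]; exact Nat.le_ceil _
  have hq1 : 1 ≤ q := by exact_mod_cast ha1.trans hqa
  have hqa' : (q : ℝ) ≤ 2 * a := by
    have := (Nat.ceil_lt_add_one (by positivity : 0 ≤ 1 / ε)).le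
    rw [← hq, ← ha] at this
    linarith
  have hda : 1 ≤ d * a ^ 2 := one_le_mul_of_one_le_of_one_le hd1 (one_le_pow₀ ha1)
  have hTa : (T : ℝ) ≤ (M + 1) * d * a ^ 2 := by
    have := (Nat.ceil_lt_add_one (by positivity : 0 ≤ M * d / ε ^ 2)).le
    rw [← hT] at this
    have h1 : M * d / ε ^ 2 = M * d * a ^ 2 := by rw [ha]; field_simp
    linarith
  have hb : ((params d T q).b₁ : ℝ) ≤ (M + 2) * a ^ 2 := by
    have h1 : ((params d T q).b₁ : ℝ) ≤ T / d + 1 :=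
      (Nat.ceil_lt_add_one (by positivity : 0 ≤ (T : ℝ) / d)).le
    have h2 : (T : ℝ) / d ≤ (M + 1) * a ^ 2 := by
      rw [div_le_iff₀ hd0]
      linarith
    have h3 : 1 ≤ a ^ 2 := one_le_pow₀ ha1
    linarith
  have hk : (((T + q - 1) / q : ℕ) : ℝ) ≤ (M + 2) * d * a := by
    have hq0 : (0 : ℝ) < q := by linarith
    have h1 : (((T + q - 1) / q : ℕ) : ℝ) ≤ (T + q) / q := by
      refine Nat.cast_div_le.trans ?_
      gcongr
      exact_mod_cast Nat.sub_le _ _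
    refine h1.trans ?_
    rw [div_le_iff₀ hq0]
    have h2 : (M + 1) * d * a * a ≤ (M + 1) * d * a * q := by gcongr
    have h3 : 1 * (q : ℝ) ≤ d * a * q := by
      gcongr
      exact one_le_mul_of_one_le_of_one_le hd1 ha1
    linarith
  have hmain : ((run (params d T q) F lmo z₀ B T).queries : ℝ) ≤
      2 * (params d T q).b₁ * ((T + q - 1) / q : ℕ) + 4 * q * T := by
    exact_mod_cast run_queries_le (p := params d T q) hq1 F lmo z₀ B T
  calc _ ≤ _ := hmain
    _ ≤ 2 * ((M + 2) * a ^ 2) * ((M + 2) * d * a) + 4 * (2 * a) * ((M + 1) * d * a ^ 2) := by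
        gcongr
    _ = (2 * (M + 2) ^ 2 + 8 * (M + 1)) * d / ε ^ 3 := by
        rw [ha]; field_simp; ring

end AccSZOFW

/-! ### The rate and the choice of constants. -/

theorem theorem3 (L D Δ σ : ℝ) (hL : 0 ≤ L) (hD : 0 ≤ D) (hΔ : 0 ≤ Δ) (hσ : 0 ≤ σ) :
    ∃ C M : ℝ, 0 < C ∧ 3 ≤ M ∧
      ∀ (d T q : ℕ), 1 ≤ d → 3 ≤ T → 1 ≤ q →
      ∀ (Ξ : Type*) [MeasurableSpace Ξ] (P : Measure Ξ) [IsProbabilityMeasure P]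
        (X : Set (E d)) (F : E d → Ξ → ℝ),
        Assumptions X F P (params d T q).β L D Δ σ →
      ∀ (Ω : Type*) [MeasurableSpace Ω] (μ : Measure Ω) [IsProbabilityMeasure μ]
        (sample : ℕ → ℕ → Ω → Ξ × E d) (ζ : Ω → Fin T), IsRandomness P μ sample ζ →
      ∀ (lmo : ℕ → E d → E d) (z₀ : E d), (∀ t, IsLMO X (lmo t)) → z₀ ∈ X →
      let R : Ω → ℕ → State d :=
        fun ω => run (params d T q) F lmo z₀ (fun t i => sample t i ω)
      let G : E d → ℝ := fwGap X (objective F P)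
      (∀ t < T, Integrable (fun ω => G (R ω t).z) μ) ∧
      Integrable (fun ω => G (R ω (ζ ω)).z) μ ∧
      ∫ ω, G (R ω (ζ ω)).z ∂μ = 1 / (T : ℝ) * ∑ t ∈ Finset.range T, ∫ ω, G (R ω t).z ∂μ ∧
      ∫ ω, G (R ω (ζ ω)).z ∂μ ≤
        C * (√(d : ℝ) / (T : ℝ) ^ (1 / 2 : ℝ)) +
        C * (√(d : ℝ) * Real.log T / (T : ℝ) ^ (3 / 2 : ℝ)) ∧
      (∀ ε : ℝ, 0 < ε → ε ≤ 1 → T = ⌈M * d / ε ^ 2⌉₊ → q = ⌈1 / ε⌉₊ →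
        ∫ ω, G (R ω (ζ ω)).z ∂μ ≤ ε ∧
        ∀ ω, ((R ω T).queries : ℝ) ≤ C * d / ε ^ 3) := by
  obtain ⟨C₀, hC₀⟩ : ∃ C₀, C₀ = 5 * Δ + 6 * L * D ^ 2 + D * (σ + 3 * L * D + 4 * L) + 1 :=
    ⟨_, rfl⟩
  have hC₀pos : 0 < C₀ := by rw [hC₀]; positivity
  -- `C₀ √d η ≤ ε` means `T ≥ C₀² d / ε²`; the summand `3` secures `M ≥ 3`.
  obtain ⟨M, hM⟩ : ∃ M, M = C₀ ^ 2 + 3 := ⟨_, rfl⟩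
  have hM3 : 3 ≤ M := by rw [hM]; linarith [sq_nonneg C₀]
  have hC₁ : 0 ≤ 2 * (M + 2) ^ 2 + 8 * (M + 1) := by positivity
  refine ⟨C₀ + (2 * (M + 2) ^ 2 + 8 * (M + 1)), M, by positivity, hM3, ?_⟩
  intro d T q hd hT hq Ξ _ P _ X F hA Ω _ μ _ sample ζ hr lmo z₀ hlmo hz₀ R G
  obtain ⟨hint, havg⟩ := integral_fwGap_le hd hT hq hL hD hσ hΔ hA hr hlmo hz₀
  have hη := stepSize_pos hT
  have hd0 : (0 : ℝ) < d := by positivity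
  have hT0 : (0 : ℝ) < T := by positivity
  have hT1 : (1 : ℝ) ≤ T := by exact_mod_cast (by omega : 1 ≤ T)
  have hind : ∀ k : Fin T, IndepFun ζ (fun ω => G (R ω k).z) μ := by
    intro k
    -- The gap at a fixed time is a measurable function of the whole sample array, which is what `ζ`
    -- is assumed to be independent of.
    have hm : Measurable fun s : ℕ × ℕ → Ξ × E d =>
        G (run (params d T q) F lmo z₀ (fun t i => s (t, i)) k).z := by
      have hβ0 : 0 ≤ (params d T q).β := mul_nonneg (inv_nonneg.2 hd0.le) hη.le
      obtain ⟨U, hU, hXU, -, -, -, hf⟩ := hA.exists_isSmoothOn hL hβ0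
      exact measurable_comp_of_continuousOn (continuousOn_iff_continuous_domRestrict.2
        (continuous_fwGap_restrict hA.compact
          ((continuousOn_gradient_of_isSmoothOn hL hf).mono hXU)))
        (measurable_run (p := params d T q) hA.measurable (fun t => (hlmo t).1) z₀
          (B := fun (s : ℕ × ℕ → Ξ × E d) t i => s (t, i)) k
          fun s _ i => measurable_pi_apply (s, i)).2.2.1
        fun s => (run_mem hT hA.convex hlmo hz₀ k).2.2
    exact hr.indep_index.comp measurable_id hm
  obtain ⟨hζint, hζ⟩ := integral_eval_index (Φ := fun t ω => G (R ω t).z) hr.measurable_index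
    hind fun t _ => hint t
  have hEq : ∫ ω, G (R ω (ζ ω)).z ∂μ =
      1 / (T : ℝ) * ∑ t ∈ Finset.range T, ∫ ω, G (R ω t).z ∂μ := by
    rw [hζ, Finset.sum_range, Finset.mul_sum]
    refine Finset.sum_congr rfl fun k _ => ?_
    rw [measureReal_def, hr.law_index k, ENNReal.toReal_inv, ENNReal.toReal_natCast, one_div]
  have hbound : ∫ ω, G (R ω (ζ ω)).z ∂μ ≤ C₀ * (√(d : ℝ) * stepSize T) := by
    rw [hEq]
    refine havg.trans ?_
    have : 5 * Δ + 6 * L * D ^ 2 + D * (σ + 3 * L * D + 4 * L) ≤ C₀ := by linarith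
    gcongr
  refine ⟨fun t _ => hint t, hζint, hEq, ?_, ?_⟩
  · have h1 : √(d : ℝ) / (T : ℝ) ^ (1 / 2 : ℝ) = √(d : ℝ) * stepSize T := by
      rw [stepSize_eq, ← Real.sqrt_eq_rpow, div_eq_mul_inv]
    -- The logarithmic term is nonnegative slack; the first term alone bounds the gap.
    have h2 : 0 ≤ √(d : ℝ) * Real.log T / (T : ℝ) ^ (3 / 2 : ℝ) := by
      have := Real.log_nonneg hT1
      positivity
    have h3 : 0 ≤ √(d : ℝ) * stepSize T := by positivity
    rw [h1]
    have h4 := mul_nonneg (add_nonneg hC₀pos.le hC₁) h2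
    have h5 := mul_nonneg hC₁ h3
    linarith
  · intro ε hε hε1 hTε hqε
    constructor
    · refine hbound.trans ?_
      have h1 : M * d / ε ^ 2 ≤ T := by rw [hTε]; exact Nat.le_ceil _
      refine le_of_sq_le_sq ?_ hε.le
      rw [mul_pow, mul_pow, Real.sq_sqrt hd0.le, stepSize_sq, ← mul_assoc, ← div_eq_mul_inv,
        div_le_iff₀ hT0]
      rw [div_le_iff₀ (by positivity)] at h1
      have h2 : C₀ ^ 2 * d ≤ M * d := by
        gcongr
        linarith
      linarith
    · intro ω
      refine (run_queries_le_of_accuracy hd (by linarith) hε hε1 hTε hqε F lmo z₀ _).trans ?_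
      have h1 : 2 * (M + 2) ^ 2 + 8 * (M + 1) ≤ C₀ + (2 * (M + 2) ^ 2 + 8 * (M + 1)) := by
        linarith
      have h2 : 0 ≤ (d : ℝ) / ε ^ 3 := by positivity
      simpa only [mul_div_assoc] using mul_le_mul_of_nonneg_right h1 h2
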